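/- Let $(R,\mathfrak m)$ be a Cohen–Macaulay (Noetherian) local ring of dimension $d\ge 2$ with infinite residue field, and let $I$ be an $\mathfrak m$-primary ideal. For all large $r,s$ write $$\ell(R/\mathfrak m^rI^s)=\sum_{i+j\le d}e_{ij}\binom{r+i}{i}\binom{s+j}{j},\qquad e_{ij}\in\mathbb Z,$$ and put $e_{d-1}(\mathfrak m|I)=e_{1,d-1}$. Assume that $I$ has minimal mixed multiplicity, that is, $\mu(I)=e_{d-1}(\mathfrak m|I)+d-1$, where $\mu(I)$ is the minimal number of generators of $I$. Let $R[It]=\bigoplus_{n\ge0}I^nt^n$, $G(I)=R[It]\otimes_RR/I=\bigoplus_{n\ge0} I^n/I^{n+1}$ and $F(I)=R[It]\otimes_R R/\mathfrak m=\bigoplus_{n\ge0} I^n/\mathfrak mI^n$. For $a\in I$ let $a^*$ be the class of $a$ in $I/I^2=G(I)_1$ and $a^o$ the class of $a$ in $I/\mathfrak mI=F(I)_1$. (1) Let $x\in\mathfrak m$, $a_1,\dots,a_{d-1}\in I$ be a joint reduction of the $d$ ideals $\mathfrak m,I,\dots,I$ ($d-1$ copies of $I$), that is, for some $n\ge1$,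 $$\bigl[x\,I^{d-1}+(a_1,\dots,a_{d-1})\,\mathfrak m I^{d-2}\bigr](\mathfrak mI^{d-1})^{n-1}=(\mathfrak mI^{d-1})^n .$$ Let $0\le t\le d-1$. If $a_1^*,\dots,a_t^*$ is a regular sequence in $G(I)$, then $a_1^o,\dots,a_t^o$ is a regular sequence in $F(I)$. (2) In particular, if $\operatorname{depth}G(I)\ge d-1$, then $\operatorname{depth}F(I)\ge d-1$. Here the depth of $G(I)$, respectively $F(I)$, is the supremum of the lengths of the regular sequences contained in its homogeneous maximal ideal. -/

import Mathlib

open IsLocalRing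

noncomputable section

/-- The grade of an ideal `J` of a ring `S`: the supremum of the lengths of the `S`-regular sequences
contained in `J`. -/
def idealGrade {S : Type*} [CommRing S] (J : Ideal S) : ℕ∞ :=
  ⨆ rs : {rs : List S // (∀ r ∈ rs, r ∈ J) ∧ RingTheory.Sequence.IsRegular S rs},
    (rs.1.length : ℕ∞)

/-- A Noetherian local ring is Cohen-Macaulay if its depth equals its Krull dimension. -/
def IsCohenMacaulayLocal (R : Type*) [CommRing R] [IsLocalRing R] : Prop :=
  IsNoetherianRing R ∧ (idealGrade (maximalIdeal R) : WithBot ℕ∞) = ringKrullDim R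

/-- `x = (x_i)` is a joint reduction of the ideals `J = (J_i)`: `x_i ∈ J_i` for all `i`, and
`[∑_j x_j J_1 ⋯ Ĵ_j ⋯ J_k] (J_1 ⋯ J_k)^(n-1) = (J_1 ⋯ J_k)^n` for some `n ≥ 1`. -/
def IsJointReduction {R : Type*} [CommRing R] {k : ℕ} (J : Fin k → Ideal R) (x : Fin k → R) :
    Prop :=
  (∀ i, x i ∈ J i) ∧
    ∃ n : ℕ, 1 ≤ n ∧
      (∑ j, Ideal.span {x j} * ∏ i ∈ Finset.univ.erase j, J i) * (∏ i, J i) ^ (n - 1) =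
        (∏ i, J i) ^ n

/-- The integers `e i j` (`i + j ≤ d`) are the coefficients of the Bhattacharya polynomial of `𝔪`
and `I`: for all large `r` and `s`,
`ℓ(R / 𝔪^r I^s) = ∑_{i + j ≤ d} e_{ij} (r + i choose i) (s + j choose j)`. -/
def IsBhattacharyaCoeffs {R : Type*} [CommRing R] [IsLocalRing R] (I : Ideal R) (d : ℕ)
    (e : ℕ → ℕ → ℤ) : Prop :=
  ∃ N : ℕ, ∀ r s : ℕ, N ≤ r → N ≤ s →
    ∃ l : ℕ, Module.length R (R ⧸ (maximalIdeal R ^ r * I ^ s)) = (l : ℕ∞) ∧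
      (l : ℤ) = ∑ k ∈ Finset.range (d + 1), ∑ p ∈ Finset.HasAntidiagonal.antidiagonal k,
        e p.1 p.2 * (((r + p.1).choose p.1 : ℕ) : ℤ) * (((s + p.2).choose p.2 : ℕ) : ℤ)

/-- The integer `c` is the mixed multiplicity `e_j(𝔪|I)`, where `d = dim R` and `j ≤ d`: the
coefficient `e_{d-j,j}` of the Bhattacharya polynomial of `𝔪` and `I`. -/
def IsMixedMultiplicity {R : Type*} [CommRing R] [IsLocalRing R] (I : Ideal R) (d j : ℕ)
    (c : ℤ) : Prop :=
  ∃ e : ℕ → ℕ → ℤ, IsBhattacharyaCoeffs I d e ∧ c = e (d - j) j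

/-- `I` has minimal mixed multiplicity: `μ(I) = e_{d-1}(𝔪|I) + d - 1`, where `d = dim R` and `μ(I)`
is the minimal number of generators of `I`. -/
def HasMinimalMixedMultiplicity {R : Type*} [CommRing R] [IsLocalRing R] (I : Ideal R) (d : ℕ) :
    Prop :=
  ∃ c : ℤ, IsMixedMultiplicity I d (d - 1) c ∧
    (Submodule.spanFinrank I : ℤ) = c + (d : ℤ) - 1

/-- The associated graded ring `G(I) = R[It] ⊗_R R/I = R[It] / I R[It] = ⨁ I^n / I^(n+1)`. -/
abbrev AssocGradedRing {R : Type*} [CommRing R] (I : Ideal R) : Type _ :=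
  reesAlgebra I ⧸ I.map (algebraMap R (reesAlgebra I))

/-- The fiber cone `F(I) = R[It] ⊗_R R/𝔪 = R[It] / 𝔪 R[It] = ⨁ I^n / 𝔪 I^n`. -/
abbrev FiberCone {R : Type*} [CommRing R] [IsLocalRing R] (I : Ideal R) : Type _ :=
  reesAlgebra I ⧸ (maximalIdeal R).map (algebraMap R (reesAlgebra I))

/-- The element `a t` of the Rees algebra `R[It]`, for `a ∈ I`. -/
def reesDegreeOne {R : Type*} [CommRing R] {I : Ideal R} (a : I) : reesAlgebra I :=
  ⟨Polynomial.monomial 1 (a : R), by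
    rw [reesAlgebra.monomial_mem, pow_one]; exact a.2⟩

/-- `a^*`: the class of `a ∈ I` in `I / I^2 = G(I)_1`. -/
def starForm {R : Type*} [CommRing R] {I : Ideal R} (a : I) : AssocGradedRing I :=
  Ideal.Quotient.mk _ (reesDegreeOne a)

/-- `a^o`: the class of `a ∈ I` in `I / 𝔪 I = F(I)_1`. -/
def circForm {R : Type*} [CommRing R] [IsLocalRing R] {I : Ideal R} (a : I) : FiberCone I :=
  Ideal.Quotient.mk _ (reesDegreeOne a)

/-- The homogeneous maximal ideal `𝔪 ⊕ It ⊕ I^2 t^2 ⊕ ⋯` of the Rees algebra `R[It]`. -/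
def reesMaximalIdeal {R : Type*} [CommRing R] [IsLocalRing R] (I : Ideal R) :
    Ideal (reesAlgebra I) :=
  (maximalIdeal R).comap
    ((Polynomial.constantCoeff (R := R)).comp (reesAlgebra I).val.toRingHom)

/-- The depth of `G(I)`: the grade of its homogeneous maximal ideal `𝔪/I ⊕ I/I^2 ⊕ ⋯`. -/
def depthAssocGradedRing {R : Type*} [CommRing R] [IsLocalRing R] (I : Ideal R) : ℕ∞ :=
  idealGrade ((reesMaximalIdeal I).map
    (Ideal.Quotient.mk (I.map (algebraMap R (reesAlgebra I)))))

/-- The depth of `F(I)`: the grade of its homogeneous maximal ideal `I/𝔪I ⊕ I^2/𝔪I^2 ⊕ ⋯`. -/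
def depthFiberCone {R : Type*} [CommRing R] [IsLocalRing R] (I : Ideal R) : ℕ∞ :=
  idealGrade ((reesMaximalIdeal I).map
    (Ideal.Quotient.mk ((maximalIdeal R).map (algebraMap R (reesAlgebra I)))))

end

/-!
Let `q = (a₁, …, a_{d-1})`, where `x, a₁, …, a_{d-1}` is a joint reduction of `𝔪, I, …, I`.

**Minimality becomes an equation of ideals.** In a Cohen-Macaulay ring the joint reduction is a
system of parameters, hence regular in every order, and then `e_{d-1}(𝔪|I) = ℓ(R/(x, q))`. This is
an Euler characteristic computation. Taking the difference of `(r, s) ↦ ℓ(R/𝔪^r I^s)` in the degrees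
of `x, a₁, …, a_{d-1}` one after the other picks out the coefficient `e_{1,d-1}` of the Bhattacharya
polynomial (`iterNabla_bhattacharyaPoly`). Dividing by the elements one after the other turns it
into `ℓ(R/(x, q))`, up to kernels which are bigraded modules over `⨁ 𝔪^r I^s` whose Koszul Euler
characteristics vanish in large bidegree (`iterNabla_relLengthInt_eventuallyEq_zero`,
`relLengthInt_eq_mixedMultiplicity`). Now `(x, q) / (x I + q 𝔪)` has length at most
`ℓ(R/I) + d - 1`, so `I / (x I + q 𝔪)` has length at most `e_{d-1}(𝔪|I) + d - 1 = μ(I) = ℓ(I/𝔪I)`,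
and this forces `𝔪 I = x I + q 𝔪` (`maximalIdeal_mul_le_of_minimal`).

**From `G(I)` to `F(I)`.** Let `b` be generated by `a₁, …, a_i` and let `c = a_{i+1}`. If the initial
forms are regular in `G(I)`, the Valabrega-Valla equalities `b ∩ I^n = b I^(n-1)` hold, and `c` is
regular on the filtration of `R/b` induced by `I`. The equation `𝔪 I = x I + q 𝔪` gives
`𝔪 I^(n+1) = x I^(n+1) + 𝔪 q^(n+1)`. So if `c w ∈ 𝔪 I^(n+1) + b I^n`, the remaining generators can be
eliminated because `x, q` is regular in any order, and what is left expresses `w` as an element of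
`𝔪 I^n + b I^(n-1)` (`mem_reesComponent_of_mul_mem`, `isRegularMod_fiberCone`). This is part (1).

**Existence of a suitable joint reduction.** For part (2) the residue field is infinite, so one can
choose general elements `x ∈ 𝔪` and `a_i ∈ I` that are filter-regular on
`⨁ 𝔪^r I^s / 𝔪^(r+1) I^s`, and at the same time regular on `G(I)`, whose depth is at least `d - 1`. The
Hilbert function of that bigraded ring is killed by `d` successive differences, so the quotient by
the `d` elements vanishes in large bidegree; by Nakayama's lemma the elements are a joint reduction
(`exists_eventualReduction`), and the argument of part (1) applies to it.

Regular sequences in quotients of a ring `T` are handled through ideals of `T` (`IsRegularMod`), and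
joint reductions through the weaker relation in large bidegrees (`IsEventualReduction`).
-/

/-! ### Regular sequences modulo an ideal -/

section RegularSequences

variable {T : Type*} [CommRing T]

/-- The elements of the list form a weakly regular sequence on `T ⧸ J`, in the language of ideals
of `T`: each `c` of the list is a nonzerodivisor modulo the ideal generated by `J` and the elements
in front of `c`. -/
def IsRegularMod : Ideal T → List T → Prop
  | _, [] => True
  | J, c :: cs => (∀ y, c * y ∈ J → y ∈ J) ∧ IsRegularMod (J ⊔ Ideal.span {c}) cs

theorem isRegularMod_append (J : Ideal T) (L L' : List T) :
    IsRegularMod J (L ++ L') ↔ IsRegularMod J L ∧ IsRegularMod (J ⊔ Ideal.ofList L) L' := by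
  induction L generalizing J with
  | nil => simp [IsRegularMod]
  | cons c cs ih => simp [IsRegularMod, ih, and_assoc, sup_assoc]

theorem isRegularMod_take (J : Ideal T) {L : List T} (h : IsRegularMod J L) (k : ℕ) :
    IsRegularMod J (L.take k) := by
  rw [← L.take_append_drop k, isRegularMod_append] at h
  exact h.1

theorem isRegularMod_iff_getElem (J : Ideal T) (L : List T) :
    IsRegularMod J L ↔ ∀ i (h : i < L.length), ∀ y,
      L[i] * y ∈ J ⊔ Ideal.ofList (L.take i) → y ∈ J ⊔ Ideal.ofList (L.take i) := by
  induction L generalizing J with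
  | nil => simp [IsRegularMod]
  | cons c cs ih =>
    rw [IsRegularMod, ih]
    constructor
    · rintro ⟨h0, h⟩ i hi
      cases i with
      | zero => simpa using h0
      | succ i => simpa [sup_assoc] using h i (by simpa using hi)
    · intro h
      refine ⟨fun y hy => ?_, fun i hi y hy => ?_⟩
      · have h0 := h 0 (by simp) y
        simp only [List.take_zero, Ideal.ofList_nil, sup_bot_eq] at h0
        exact h0 hy
      · have h1 := h (i + 1) (by simpa using hi) y
        simp only [List.take_succ_cons, Ideal.ofList_cons, ← sup_assoc] at h1
        exact h1 hy

/-- Weak regularity of a sequence in a quotient ring of `T`, read off from lifts to `T`. -/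
theorem isWeaklyRegular_map_iff {S : Type*} [CommRing S] {f : T →+* S}
    (hf : Function.Surjective f) (L : List T) :
    RingTheory.Sequence.IsWeaklyRegular S (L.map f) ↔ IsRegularMod (RingHom.ker f) L := by
  rw [isRegularMod_iff_getElem, RingTheory.Sequence.isWeaklyRegular_iff]
  have key : ∀ (i : ℕ) (y : T), f y ∈ (Ideal.ofList ((L.map f).take i) • ⊤ : Ideal S) ↔
      y ∈ RingHom.ker f ⊔ Ideal.ofList (L.take i) := by
    intro i y
    rw [smul_eq_mul, Ideal.mul_top, ← List.map_take, ← Ideal.map_ofList, ← Ideal.mem_comap,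
      Ideal.comap_map_of_surjective _ hf, sup_comm, ← RingHom.ker_eq_comap_bot]
  constructor
  · intro h i hi y hy
    have := h i (by simpa using hi)
    rw [isSMulRegular_iff_right_eq_zero_of_smul] at this
    have h2 := this (Submodule.Quotient.mk (f y)) (by
      rw [← Submodule.Quotient.mk_smul, Submodule.Quotient.mk_eq_zero, smul_eq_mul,
        List.getElem_map, smul_eq_mul, ← map_mul]
      exact (key i _).2 hy)
    rw [Submodule.Quotient.mk_eq_zero] at h2
    exact (key i y).1 h2
  · intro h i hi
    rw [isSMulRegular_iff_right_eq_zero_of_smul]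
    intro y hy
    obtain ⟨y, rfl⟩ := Submodule.Quotient.mk_surjective _ y
    obtain ⟨y, rfl⟩ := hf y
    rw [← Submodule.Quotient.mk_smul, Submodule.Quotient.mk_eq_zero, smul_eq_mul,
        List.getElem_map, smul_eq_mul, ← map_mul] at hy
    rw [Submodule.Quotient.mk_eq_zero]
    exact (key i y).2 (h i (by simpa using hi) y ((key i _).1 hy))

/-- A weakly regular sequence in `T ⧸ J` is regular if it generates a proper ideal. -/
theorem isRegular_quotient_iff (J : Ideal T) (L : List T) :
    RingTheory.Sequence.IsRegular (T ⧸ J) (L.map (Ideal.Quotient.mk J)) ↔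
      IsRegularMod J L ∧ J ⊔ Ideal.ofList L ≠ ⊤ := by
  rw [RingTheory.Sequence.isRegular_iff, isWeaklyRegular_map_iff Ideal.Quotient.mk_surjective,
    Ideal.mk_ker]
  refine and_congr_right fun _ => ?_
  rw [smul_eq_mul, Ideal.mul_top, ← Ideal.map_ofList, ne_comm, not_iff_not]
  rw [← Ideal.comap_eq_top_iff (f := Ideal.Quotient.mk J),
      Ideal.comap_map_of_surjective _ Ideal.Quotient.mk_surjective, sup_comm,
      ← RingHom.ker_eq_comap_bot, Ideal.mk_ker]

theorem mem_associatedPrimes_quotient_iff [IsNoetherianRing T] {J P : Ideal T} :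
    P ∈ associatedPrimes T (T ⧸ J) ↔ P.IsPrime ∧ ∃ u : T, ∀ k, k ∈ P ↔ k * u ∈ J := by
  rw [AssociatedPrimes.mem_iff, isAssociatedPrime_iff]
  refine and_congr_right fun _ => ?_
  constructor
  · rintro ⟨x, hx⟩
    obtain ⟨u, rfl⟩ := Ideal.Quotient.mk_surjective x
    refine ⟨u, fun k => ?_⟩
    rw [hx, Submodule.mem_colon_singleton, Submodule.mem_bot, Algebra.smul_def,
      Ideal.Quotient.algebraMap_eq, ← map_mul, Ideal.Quotient.eq_zero_iff_mem]
  · rintro ⟨u, hu⟩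
    refine ⟨Ideal.Quotient.mk J u, ?_⟩
    ext k
    rw [hu, Submodule.mem_colon_singleton, Submodule.mem_bot, Algebra.smul_def,
      Ideal.Quotient.algebraMap_eq, ← map_mul, Ideal.Quotient.eq_zero_iff_mem]

theorem exists_associatedPrime_ge [IsNoetherianRing T] {J K : Ideal T} {u : T} (hu : u ∉ J)
    (hK : ∀ k ∈ K, k * u ∈ J) : ∃ P ∈ associatedPrimes T (T ⧸ J), K ≤ P := by
  obtain ⟨P, hP, hle⟩ := exists_le_isAssociatedPrime_of_isNoetherianRing T (Ideal.Quotient.mk J u)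
    (by rwa [Ne, Ideal.Quotient.eq_zero_iff_mem])
  refine ⟨P, hP, fun k hk => hle ?_⟩
  rw [Submodule.mem_colon_singleton, Submodule.mem_bot, Algebra.smul_def,
      Ideal.Quotient.algebraMap_eq, ← map_mul, Ideal.Quotient.eq_zero_iff_mem]
  exact hK k hk

theorem mem_of_mul_mem_of_notMem_associatedPrimes [IsNoetherianRing T] {J : Ideal T} {z : T}
    (hz : ∀ P ∈ associatedPrimes T (T ⧸ J), z ∉ P) (y : T) (hy : z * y ∈ J) : y ∈ J := by
  by_contra hyJ
  obtain ⟨P, hP, hle⟩ := exists_associatedPrime_ge (K := Ideal.span {z}) hyJ (by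
    intro k hk
    obtain ⟨a, rfl⟩ := Ideal.mem_span_singleton'.1 hk
    rw [mul_assoc]
    exact J.mul_mem_left _ hy)
  exact hz P hP (hle (Ideal.mem_span_singleton_self z))

/-- Prime avoidance: if for none of finitely many ideals `J` an element outside `J` is multiplied
into `J` by `M`, then some element of `M` is a nonzerodivisor modulo all of them. -/
theorem exists_mem_regular_of_colon_eq [IsNoetherianRing T] (M : Ideal T) (Js : List (Ideal T))
    (h : ∀ J ∈ Js, ∀ u, (∀ k ∈ M, k * u ∈ J) → u ∈ J) :
    ∃ z ∈ M, ∀ J ∈ Js, ∀ y, z * y ∈ J → y ∈ J := by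
  classical
  have hfin : (⋃ J ∈ {J | J ∈ Js}, associatedPrimes T (T ⧸ J)).Finite :=
    (List.finite_toSet Js).biUnion fun J _ => associatedPrimes.finite T (T ⧸ J)
  by_contra! hcon
  have hsub : (M : Set T) ⊆ ⋃ P ∈ (hfin.toFinset : Set (Ideal T)), (P : Set T) := by
    intro z hz
    obtain ⟨J, hJ, y, hy, hyJ⟩ := hcon z hz
    by_contra hz'
    refine hyJ (mem_of_mul_mem_of_notMem_associatedPrimes (fun P hP hzP => hz' ?_) y hy)
    simp only [Set.mem_iUnion]
    exact ⟨P, by simpa using ⟨J, hJ, hP⟩, hzP⟩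
  obtain ⟨P, hP, hle⟩ := (Ideal.subset_union_prime (f := fun P : Ideal T => P) ⊥ ⊥ (by
    intro P hP _ _
    simp only [Set.Finite.mem_toFinset, Set.mem_iUnion] at hP
    obtain ⟨J, _, hP⟩ := hP
    exact hP.isPrime)).1 hsub
  simp only [Set.Finite.mem_toFinset, Set.mem_iUnion] at hP
  obtain ⟨J, hJ, hP⟩ := hP
  obtain ⟨hp, u, hu⟩ := mem_associatedPrimes_quotient_iff.1 hP
  refine hp.ne_top ((Ideal.eq_top_iff_one _).2 ((hu 1).2 ?_))
  rw [one_mul]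
  exact h J hJ u fun k hk => (hu k).1 (hle hk)

theorem mul_mem_sup_span_singleton {J : Ideal T} {x y : T} :
    y ∈ J ⊔ Ideal.span {x} ↔ ∃ v, y - x * v ∈ J := by
  rw [sup_comm, Ideal.mem_span_singleton_sup]
  constructor
  · rintro ⟨v, j, hj, rfl⟩
    exact ⟨v, by ring_nf; exact hj⟩
  · rintro ⟨v, hv⟩
    exact ⟨v, _, hv, by ring⟩

/-- Whether `M` kills a nonzero element of `T ⧸ (J, x)` does not depend on the choice of
`x ∈ M` regular modulo `J`: if `M u ⊆ (J, x)` and `y u = x v` modulo `J`, then `u ↦ v` turns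
socle elements modulo `(J, x)` into socle elements modulo `(J, y)`. -/
theorem colon_le_of_regular {J M : Ideal T} {x y : T} (hy : y ∈ M)
    (hxr : ∀ u, x * u ∈ J → u ∈ J) (hyr : ∀ u, y * u ∈ J → u ∈ J)
    (h : ∀ u, (∀ k ∈ M, k * u ∈ J ⊔ Ideal.span {y}) → u ∈ J ⊔ Ideal.span {y}) (u : T)
    (hu : ∀ k ∈ M, k * u ∈ J ⊔ Ideal.span {x}) : u ∈ J ⊔ Ideal.span {x} := by
  obtain ⟨v, hv⟩ := mul_mem_sup_span_singleton.1 (hu y hy)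
  have hvy : v ∈ J ⊔ Ideal.span {y} := by
    refine h v fun k hk => ?_
    obtain ⟨w, hw⟩ := mul_mem_sup_span_singleton.1 (hu k hk)
    refine mul_mem_sup_span_singleton.2 ⟨w, hxr _ ?_⟩
    have := J.sub_mem (J.mul_mem_left y hw) (J.mul_mem_left k hv)
    convert this using 1
    ring
  obtain ⟨w, hw⟩ := mul_mem_sup_span_singleton.1 hvy
  refine mul_mem_sup_span_singleton.2 ⟨w, hyr _ ?_⟩
  have := J.add_mem hv (J.mul_mem_left x hw)
  convert this using 1
  ring

theorem regular_swap {J : Ideal T} {y z : T} (hy : ∀ u, y * u ∈ J → u ∈ J)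
    (hz : ∀ u, z * u ∈ J ⊔ Ideal.span {y} → u ∈ J ⊔ Ideal.span {y}) (u : T)
    (hu : y * u ∈ J ⊔ Ideal.span {z}) : u ∈ J ⊔ Ideal.span {z} := by
  obtain ⟨v, hv⟩ := mul_mem_sup_span_singleton.1 hu
  obtain ⟨w, hw⟩ := mul_mem_sup_span_singleton.1 (hz v (mul_mem_sup_span_singleton.2
    ⟨u, by rw [← neg_sub]; exact J.neg_mem hv⟩))
  refine mul_mem_sup_span_singleton.2 ⟨w, hy _ ?_⟩
  have := J.add_mem hv (J.mul_mem_left z hw)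
  convert this using 1
  ring

/-- Exchange: if `M` contains a regular sequence of length `n + 1` modulo `J`, and `x ∈ M` is
regular modulo `J`, then `M` contains a regular sequence of length `n` modulo `(J, x)`. -/
theorem exists_isRegularMod_sup_span [IsNoetherianRing T] (M : Ideal T) (n : ℕ) :
    ∀ (J : Ideal T) (L : List T), L.length = n + 1 → (∀ y ∈ L, y ∈ M) → IsRegularMod J L →
    ∀ x ∈ M, (∀ u, x * u ∈ J → u ∈ J) →
    ∃ L' : List T, L'.length = n ∧ (∀ y ∈ L', y ∈ M) ∧ IsRegularMod (J ⊔ Ideal.span {x}) L' := by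
  induction n with
  | zero => exact fun J L _ _ _ x _ _ => ⟨[], rfl, by simp, trivial⟩
  | succ n ih =>
    intro J L hL hLM hreg x hx hxr
    match L, hL with
    | y :: y' :: ys, hL =>
      obtain ⟨hyr, hy'r, hysr⟩ := hreg
      have hy : y ∈ M := hLM y (by simp)
      have hy' : y' ∈ M := hLM y' (by simp)
      have hsocle : ∀ u, (∀ k ∈ M, k * u ∈ J ⊔ Ideal.span {y}) → u ∈ J ⊔ Ideal.span {y} :=
        fun u hu => hy'r u (hu y' hy')
      -- `z` is regular modulo `J`, `(J, x)` and `(J, y)`, so it links `x` to `y`.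
      obtain ⟨z, hz, hzr⟩ := exists_mem_regular_of_colon_eq M
        [J, J ⊔ Ideal.span {x}, J ⊔ Ideal.span {y}] (by
          intro J' hJ' u hu
          simp only [List.mem_cons, List.not_mem_nil, or_false] at hJ'
          rcases hJ' with rfl | rfl | rfl
          · exact hyr u (hu y hy)
          · exact colon_le_of_regular hy hxr hyr hsocle u hu
          · exact hsocle u hu)
      have hzJ := hzr J (by simp)
      have hzx := hzr (J ⊔ Ideal.span {x}) (by simp)
      have hzy := hzr (J ⊔ Ideal.span {y}) (by simp)
      obtain ⟨L₁, hL₁, hL₁M, hL₁r⟩ := ih (J ⊔ Ideal.span {y}) (y' :: ys) (by simpa using hL)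
        (fun w hw => hLM w (List.mem_cons_of_mem _ hw)) ⟨hy'r, hysr⟩ z hz hzy
      rw [sup_right_comm] at hL₁r
      obtain ⟨L₂, hL₂, hL₂M, hL₂r⟩ := ih (J ⊔ Ideal.span {z}) (y :: L₁) (by simp [hL₁])
        (by simpa using ⟨hy, hL₁M⟩) ⟨regular_swap hyr hzy, hL₁r⟩ x hx (regular_swap hxr hzx)
      rw [sup_right_comm] at hL₂r
      exact ⟨z :: L₂, by simp [hL₂], by simpa using ⟨hz, hL₂M⟩, hzx, hL₂r⟩

end RegularSequences

/-! ### Systems of parameters in Cohen-Macaulay local rings -/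

section CohenMacaulay

variable {R : Type*} [CommRing R] [IsLocalRing R] [IsNoetherianRing R]

/-- Nakayama's lemma for ideals of a local ring. -/
theorem Ideal.le_of_le_sup_maximalIdeal_mul {A B : Ideal R}
    (h : A ≤ B ⊔ maximalIdeal R * A) : A ≤ B :=
  Submodule.le_of_le_smul_of_le_jacobson_bot (IsNoetherian.noetherian A)
    (IsLocalRing.maximalIdeal_le_jacobson ⊥) h

/-- Dividing by a regular element `y` makes an associated prime grow into one that contains `y`. -/
theorem exists_associatedPrime_sup_span {J P : Ideal R} {y : R} (hy : y ∈ maximalIdeal R)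
    (hyr : ∀ u, y * u ∈ J → u ∈ J) (hP : P ∈ associatedPrimes R (R ⧸ J)) :
    ∃ P' ∈ associatedPrimes R (R ⧸ (J ⊔ Ideal.span {y})), P ≤ P' ∧ y ∈ P' := by
  obtain ⟨hp, u, hu⟩ := mem_associatedPrimes_quotient_iff.1 hP
  have huJ : u ∉ J := fun h => hp.ne_top ((Ideal.eq_top_iff_one _).2 ((hu 1).2 (by simpa)))
  obtain ⟨v, hvP, hv⟩ : ∃ v, (∀ k ∈ P, k * v ∈ J) ∧ v ∉ J ⊔ Ideal.span {y} := by
    by_contra! hcon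
    have hle : Submodule.colon J (P : Set R) ≤ J := by
      refine Ideal.le_of_le_sup_maximalIdeal_mul fun v hv => ?_
      rw [Submodule.mem_colon] at hv
      have hv' : ∀ k ∈ P, k * v ∈ J := fun k hk => by simpa [mul_comm] using hv k hk
      obtain ⟨w, hw⟩ := mul_mem_sup_span_singleton.1 (hcon v hv')
      rw [show v = (v - y * w) + y * w by ring]
      refine Submodule.add_mem_sup hw (Ideal.mul_mem_mul hy ?_)
      rw [Submodule.mem_colon]
      intro k hk
      rw [smul_eq_mul, mul_comm]
      refine hyr _ ?_
      have := J.sub_mem (hv' k hk) (J.mul_mem_left k hw)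
      convert this using 1
      ring
    refine huJ (hle (Submodule.mem_colon.2 fun k hk => ?_))
    rw [smul_eq_mul, mul_comm]
    exact (hu k).1 hk
  obtain ⟨P', hP', hle⟩ := exists_associatedPrime_ge (K := P ⊔ Ideal.span {y}) hv (by
    intro k hk
    obtain ⟨w, hw⟩ := mul_mem_sup_span_singleton.1 hk
    refine mul_mem_sup_span_singleton.2 ⟨w * v, ?_⟩
    convert hvP _ hw using 1
    ring)
  exact ⟨P', hP', le_sup_left.trans hle, hle (Ideal.mem_sup_right (Ideal.mem_span_singleton_self y))⟩

/-- The depth of `R ⧸ J` is at most the dimension of `R ⧸ P` for each associated prime `P`. -/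
theorem length_le_ringKrullDim_quotient (L : List R) : ∀ {J P : Ideal R},
    (∀ y ∈ L, y ∈ maximalIdeal R) → IsRegularMod J L → P ∈ associatedPrimes R (R ⧸ J) →
    (L.length : WithBot ℕ∞) ≤ ringKrullDim (R ⧸ P) := by
  induction L with
  | nil =>
    intro J P _ _ hP
    have := Ideal.Quotient.nontrivial_iff.2 hP.isPrime.ne_top
    simpa using ringKrullDim_nonneg_of_nontrivial (R := R ⧸ P)
  | cons y ys ih =>
    rintro J P hL ⟨hyr, hreg⟩ hP
    have hp := hP.isPrime
    obtain ⟨P', hP', hle, hyP'⟩ := exists_associatedPrime_sup_span (hL y (by simp)) hyr hP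
    have hyP : y ∉ P := by
      obtain ⟨hp, u, hu⟩ := mem_associatedPrimes_quotient_iff.1 hP
      exact fun h => hp.ne_top ((Ideal.eq_top_iff_one _).2
        ((hu 1).2 (by simpa using hyr u ((hu y).1 h))))
    have h1 := ih (fun z hz => hL z (List.mem_cons_of_mem _ hz)) hreg hP'
    have h2 := ringKrullDim_succ_le_of_surjective (Ideal.Quotient.factor hle)
      (Ideal.Quotient.factor_surjective hle) (r := Ideal.Quotient.mk P y)
      (mem_nonZeroDivisors_of_ne_zero (by rwa [Ne, Ideal.Quotient.eq_zero_iff_mem]))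
      (by rwa [Ideal.Quotient.factor_mk, Ideal.Quotient.eq_zero_iff_mem])
    refine le_trans ?_ h2
    rw [List.length_cons, Nat.cast_succ]
    gcongr

/-- By Krull's height theorem, a quotient in which `n` elements generate an `𝔪`-primary ideal has
dimension at most `n`. -/
theorem ringKrullDim_quotient_le_length {P : Ideal R} (hP : P.IsPrime) (L : List R)
    (hLm : ∀ y ∈ L, y ∈ maximalIdeal R)
    (hL : maximalIdeal R ≤ (P ⊔ Ideal.ofList L).radical) :
    ringKrullDim (R ⧸ P) ≤ L.length := by
  classical
  have : Nontrivial (R ⧸ P) := Ideal.Quotient.nontrivial_iff.2 hP.ne_top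
  have : IsLocalRing (R ⧸ P) :=
    IsLocalRing.of_surjective' (Ideal.Quotient.mk P) Ideal.Quotient.mk_surjective
  have hloc : ∀ z : R, Ideal.Quotient.mk P z ∈ maximalIdeal (R ⧸ P) ↔ z ∈ maximalIdeal R := by
    intro z
    have := IsLocalHom.of_surjective (Ideal.Quotient.mk P) Ideal.Quotient.mk_surjective
    rw [← Ideal.mem_comap, IsLocalRing.maximalIdeal_comap]
  rw [← IsLocalRing.maximalIdeal_height_eq_ringKrullDim]
  have hmin : maximalIdeal (R ⧸ P) ∈
      (Ideal.span ((L.map (Ideal.Quotient.mk P)).toFinset : Set (R ⧸ P))).minimalPrimes := by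
    refine ⟨⟨inferInstance, Ideal.span_le.2 fun z hz => ?_⟩, fun Q ⟨hQ, hQs⟩ _ z hz => ?_⟩
    · simp only [List.coe_toFinset, List.mem_map, Set.mem_ofPred_eq] at hz
      obtain ⟨y, hy, rfl⟩ := hz
      exact (hloc y).2 (hLm y hy)
    · obtain ⟨z, rfl⟩ := Ideal.Quotient.mk_surjective z
      have hle : P ⊔ Ideal.ofList L ≤ Q.comap (Ideal.Quotient.mk P) := by
        refine sup_le (fun p hp => ?_) (Ideal.span_le.2 fun y hy => ?_)
        · rw [Ideal.mem_comap, Ideal.Quotient.eq_zero_iff_mem.2 hp]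
          exact Q.zero_mem
        · refine hQs (Ideal.subset_span ?_)
          simp only [List.coe_toFinset, List.mem_map, Set.mem_ofPred_eq]
          exact ⟨y, hy, rfl⟩
      exact ((Ideal.IsPrime.comap (Ideal.Quotient.mk P)).radical_le_iff.2 hle)
        (hL ((hloc z).1 hz))
  have h := Ideal.height_le_card_of_mem_minimalPrimes_span_finset hmin
  have h' : (L.map (Ideal.Quotient.mk P)).toFinset.card ≤ L.length := by
    simpa using List.toFinset_card_le (L.map (Ideal.Quotient.mk P))
  exact_mod_cast h.trans (by exact_mod_cast h')

/-- If the maximal ideal contains a regular sequence modulo `J` of length `n`, then every sequence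
of `n` elements generating an `𝔪`-primary ideal modulo `J` is regular modulo `J`. -/
theorem isRegularMod_of_maximalIdeal_le_radical (L : List R) : ∀ (J : Ideal R) (L' : List R),
    L'.length = L.length → (∀ y ∈ L', y ∈ maximalIdeal R) → IsRegularMod J L' →
    (∀ y ∈ L, y ∈ maximalIdeal R) → maximalIdeal R ≤ (J ⊔ Ideal.ofList L).radical →
    IsRegularMod J L := by
  induction L with
  | nil => exact fun _ _ _ _ _ _ _ => trivial
  | cons x xs ih =>
    intro J L' hlen hL'm hL' hLm hrad
    have hx := hLm x (by simp)
    have hxr : ∀ u, x * u ∈ J → u ∈ J := by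
      refine mem_of_mul_mem_of_notMem_associatedPrimes fun P hP hxP => ?_
      have h1 := length_le_ringKrullDim_quotient L' hL'm hL' hP
      have hJP : J ≤ P := by
        obtain ⟨hp, u, hu⟩ := mem_associatedPrimes_quotient_iff.1 hP
        exact fun j hj => (hu j).2 (J.mul_mem_right u hj)
      have h2 := ringKrullDim_quotient_le_length hP.isPrime xs
        (fun z hz => hLm z (List.mem_cons_of_mem _ hz))
        (hrad.trans (Ideal.radical_mono (sup_le (hJP.trans le_sup_left) (by
          rw [Ideal.ofList_cons]
          exact sup_le_sup_right ((Ideal.span_singleton_le_iff_mem _).2 hxP) _))))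
      have h3 := h1.trans h2
      rw [hlen, List.length_cons] at h3
      have h4 : xs.length + 1 ≤ xs.length := by exact_mod_cast h3
      omega
    obtain ⟨L₁, hL₁, hL₁m, hL₁r⟩ := exists_isRegularMod_sup_span (maximalIdeal R) xs.length J L'
      (by simpa using hlen) hL'm hL' x hx hxr
    refine ⟨hxr, ih _ L₁ hL₁ hL₁m hL₁r (fun z hz => hLm z (List.mem_cons_of_mem _ hz)) ?_⟩
    rwa [Ideal.ofList_cons, ← sup_assoc] at hrad

end CohenMacaulay

/-- An ideal of grade at least `n` contains a weakly regular sequence of length `n`. -/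
theorem exists_isRegularMod_of_le_idealGrade {T S : Type*} [CommRing T] [CommRing S] {f : T →+* S}
    (hf : Function.Surjective f) {M : Ideal T} {n : ℕ} (h : (n : ℕ∞) ≤ idealGrade (M.map f))
    (hM : RingHom.ker f ≤ M) :
    ∃ L : List T, L.length = n ∧ (∀ y ∈ L, y ∈ M) ∧ IsRegularMod (RingHom.ker f) L := by
  rcases Nat.eq_zero_or_pos n with rfl | hn
  · exact ⟨[], rfl, by simp, trivial⟩
  have hlt : ((n - 1 : ℕ) : ℕ∞) < idealGrade (M.map f) :=
    lt_of_lt_of_le (by exact_mod_cast Nat.sub_lt hn one_pos) h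
  obtain ⟨⟨rs, hrs, hreg⟩, hlen⟩ := lt_iSup_iff.1 hlt
  have hlen' : n ≤ rs.length := by
    have : n - 1 < rs.length := by exact_mod_cast hlen
    omega
  obtain ⟨L, rfl⟩ := List.map_surjective_iff.2 hf rs
  refine ⟨L.take n, by simpa using hlen', fun y hy => ?_,
    isRegularMod_take _ ((isWeaklyRegular_map_iff hf L).1 hreg.toIsWeaklyRegular) n⟩
  have := hrs _ (List.mem_map_of_mem (List.mem_of_mem_take hy))
  rw [← Ideal.mem_comap, Ideal.comap_map_of_surjective _ hf,
    ← RingHom.ker_eq_comap_bot, sup_of_le_left hM] at this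
  exact this

/-- In a Cohen-Macaulay local ring of dimension `d`, every sequence of `d` elements that generates
an `𝔪`-primary ideal is regular. -/
theorem IsCohenMacaulayLocal.isRegularMod {R : Type*} [CommRing R] [IsLocalRing R]
    (hCM : IsCohenMacaulayLocal R) (L : List R)
    (hdim : ringKrullDim R = (L.length : WithBot ℕ∞)) (hL : ∀ y ∈ L, y ∈ maximalIdeal R)
    (hrad : maximalIdeal R ≤ (Ideal.ofList L).radical) : IsRegularMod ⊥ L := by
  have := hCM.1
  have hgr : idealGrade (maximalIdeal R) = L.length := by
    have := hCM.2.trans hdim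
    exact_mod_cast this
  obtain ⟨L', hlen, hL'm, hL'⟩ := exists_isRegularMod_of_le_idealGrade (f := RingHom.id R)
    Function.surjective_id (by rw [Ideal.map_id, hgr])
    (by rw [(RingHom.injective_iff_ker_eq_bot _).1 Function.injective_id]; exact bot_le)
  rw [(RingHom.injective_iff_ker_eq_bot (RingHom.id R)).1 Function.injective_id] at hL'
  exact isRegularMod_of_maximalIdeal_le_radical L ⊥ L' hlen hL'm hL' hL (by simpa using hrad)

/-! ### Regularity in the fiber cone, in terms of ideals -/

section Components

variable {R : Type*} [CommRing R]

theorem sup_pow_succ_le (B Q : Ideal R) (k : ℕ) :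
    (B ⊔ Q) ^ (k + 1) ≤ B * (B ⊔ Q) ^ k ⊔ Q ^ (k + 1) := by
  induction k with
  | zero => simp
  | succ k ih =>
    calc (B ⊔ Q) ^ (k + 1 + 1) = B * (B ⊔ Q) ^ (k + 1) ⊔ Q * (B ⊔ Q) ^ (k + 1) := by
          rw [pow_succ' _ (k + 1), Ideal.sup_mul]
      _ ≤ B * (B ⊔ Q) ^ (k + 1) ⊔ Q * (B * (B ⊔ Q) ^ k ⊔ Q ^ (k + 1)) := by gcongr
      _ ≤ _ := by
          rw [Ideal.mul_sup, ← pow_succ' Q]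
          refine sup_le le_sup_left (sup_le (le_sup_of_le_left ?_) le_sup_right)
          rw [mul_left_comm, pow_succ' (B ⊔ Q)]
          gcongr
          exact le_sup_right

/-- A sequence regular modulo `J` generates an ideal whose powers meet `J` in the products. -/
theorem inf_pow_le_mul_pow_of_isRegularMod (L : List R) : ∀ (J : Ideal R), IsRegularMod J L →
    ∀ k, J ⊓ Ideal.ofList L ^ k ≤ J * Ideal.ofList L ^ k := by
  induction L with
  | nil =>
    intro J _ k
    cases k with
    | zero => simp
    | succ k =>
      rw [Ideal.ofList_nil, ← Ideal.zero_eq_bot, zero_pow k.succ_ne_zero, mul_zero]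
      exact inf_le_right
  | cons c cs ih =>
    rintro J ⟨hc, hcs⟩ k
    rw [Ideal.ofList_cons]
    set Q := Ideal.ofList cs
    induction k with
    | zero => simp
    | succ k ihk =>
      intro z hzz
      obtain ⟨hzJ, hz⟩ := Ideal.mem_inf.1 hzz
      have hQ : Q ≤ Ideal.span {c} ⊔ Q := le_sup_right
      have hz' : z ∈ Ideal.span {c} * (Ideal.span {c} ⊔ Q) ^ k ⊔ Q ^ (k + 1) :=
        sup_pow_succ_le _ _ _ hz
      obtain ⟨y', hy', w, hw, rfl⟩ := Submodule.mem_sup.1 hz'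
      obtain ⟨y, hy, rfl⟩ := Ideal.mem_span_singleton_mul.1 hy'
      have hwJ : w ∈ (J ⊔ Ideal.span {c}) ⊓ Q ^ (k + 1) :=
        Ideal.mem_inf.2 ⟨mul_mem_sup_span_singleton.2 ⟨-y, by convert hzJ using 1; ring⟩, hw⟩
      have hw' := ih _ hcs _ hwJ
      rw [Ideal.sup_mul] at hw'
      obtain ⟨j, hj, w₁', hw₁', rfl⟩ := Submodule.mem_sup.1 hw'
      obtain ⟨w₁, hw₁, rfl⟩ := Ideal.mem_span_singleton_mul.1 hw₁'
      have hj' : j ∈ J * (Ideal.span {c} ⊔ Q) ^ (k + 1) :=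
        Ideal.mul_mono_right (Ideal.pow_right_mono hQ _) hj
      have hs : y + w₁ ∈ J * (Ideal.span {c} ⊔ Q) ^ k := by
        refine ihk (Ideal.mem_inf.2 ⟨hc _ ?_, Ideal.add_mem _ hy ?_⟩)
        · have := J.sub_mem hzJ (Ideal.mul_le_left hj)
          convert this using 1
          ring
        · exact Ideal.pow_right_mono hQ _ (Ideal.pow_le_pow_right k.le_succ hw₁)
      have hcs' : c * (y + w₁) ∈ J * (Ideal.span {c} ⊔ Q) ^ (k + 1) := by
        rw [pow_succ, ← mul_assoc, mul_comm c]
        exact Ideal.mul_mem_mul hs (Ideal.mem_sup_left (Ideal.mem_span_singleton_self c))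
      convert Ideal.add_mem _ hj' hcs' using 1
      ring

/-- The component of degree `n` of the ideal generated by `𝔞` and `b t` in the Rees algebra
`R[It]`, for `b ≤ 𝔞 ⊓ I`. In degree `0` the truncated exponent is harmless, as `b ≤ 𝔞`. -/
def reesComponent (𝔞 I b : Ideal R) (n : ℕ) : Ideal R := 𝔞 * I ^ n ⊔ b * I ^ (n - 1)

variable {I b : Ideal R} {c : R}

/-- If `c t` is regular on `G(I) ⧸ (b t)` and the powers of `I` meet `b` in the expected way, then
`c` is a nonzerodivisor on the filtration of `R ⧸ b` induced by `I`. -/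
theorem mem_pow_sup_of_mul_mem (hcI : c ∈ I) (hVV : ∀ n, b ⊓ I ^ n ≤ b * I ^ (n - 1))
    (hreg : ∀ n, ∀ w ∈ I ^ n, c * w ∈ reesComponent I I b (n + 1) → w ∈ reesComponent I I b n)
    (n : ℕ) : ∀ p, c * p ∈ I ^ (n + 1) ⊔ b → p ∈ I ^ n ⊔ b := by
  induction n with
  | zero => simp
  | succ n ih =>
    intro p hp
    have hp' : c * p ∈ I ^ (n + 1) ⊔ b :=
      sup_le_sup_right (Ideal.pow_le_pow_right (Nat.le_succ _)) b hp
    obtain ⟨p₁, hp₁, b₁, hb₁, rfl⟩ := Submodule.mem_sup.1 (ih p hp')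
    obtain ⟨y, hy, b₂, hb₂, h⟩ := Submodule.mem_sup.1 hp
    refine Ideal.add_mem _ ?_ (Ideal.mem_sup_right hb₁)
    have hcp : c * p₁ ∈ I ^ (n + 1) := by
      rw [pow_succ']
      exact Ideal.mul_mem_mul hcI hp₁
    have hb' : b₂ - c * b₁ ∈ b * I ^ (n + 1 - 1) := by
      refine hVV _ (Ideal.mem_inf.2 ⟨b.sub_mem hb₂ (b.mul_mem_left c hb₁), ?_⟩)
      rw [show b₂ - c * b₁ = c * p₁ - y by linear_combination h]
      exact Ideal.sub_mem _ hcp (Ideal.pow_le_pow_right (Nat.le_succ _) hy)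
    have hmem : p₁ ∈ I * I ^ n ⊔ b * I ^ (n - 1) := by
      refine hreg n p₁ hp₁ ?_
      rw [show c * p₁ = y + (b₂ - c * b₁) by linear_combination -h]
      refine Submodule.add_mem_sup ?_ hb'
      rwa [← pow_succ']
    rw [← pow_succ'] at hmem
    have hle : I ^ (n + 1) ⊔ b * I ^ (n - 1) ≤ I ^ (n + 1) ⊔ b :=
      sup_le_sup_left Ideal.mul_le_left _
    exact hle hmem

/-- The Valabrega-Valla equalities pass from `b` to `b + (c)`. -/
theorem inf_pow_le_mul_pow_sup_span (hVV : ∀ n, b ⊓ I ^ n ≤ b * I ^ (n - 1)) (hcI : c ∈ I)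
    (hreg : ∀ n p, c * p ∈ I ^ (n + 1) ⊔ b → p ∈ I ^ n ⊔ b) (n : ℕ) :
    (b ⊔ Ideal.span {c}) ⊓ I ^ n ≤ (b ⊔ Ideal.span {c}) * I ^ (n - 1) := by
  cases n with
  | zero => simp
  | succ n =>
    intro y hyy
    obtain ⟨hy, hyI⟩ := Ideal.mem_inf.1 hyy
    obtain ⟨p, hp⟩ := mul_mem_sup_span_singleton.1 hy
    obtain ⟨p₁, hp₁, b₁, hb₁, rfl⟩ := Submodule.mem_sup.1 (hreg n p (by
      rw [show c * p = y - (y - c * p) by ring]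
      exact Ideal.sub_mem _ (Ideal.mem_sup_left hyI) (Ideal.mem_sup_right hp)))
    have h1 : y - c * p₁ ∈ b * I ^ (n + 1 - 1) := by
      refine hVV (n + 1) (Ideal.mem_inf.2 ⟨?_, Ideal.sub_mem _ hyI ?_⟩)
      · convert b.add_mem hp (b.mul_mem_left c hb₁) using 1
        ring
      · rw [pow_succ']
        exact Ideal.mul_mem_mul hcI hp₁
    rw [show y = (y - c * p₁) + c * p₁ by ring, Ideal.sup_mul]
    exact Submodule.add_mem_sup h1 (Ideal.mul_mem_mul (Ideal.mem_span_singleton_self c) hp₁)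

/-- Under `𝔪 I = x I + q 𝔪` with `x` and `q = b + (c) + q'` generated by a sequence regular in
every order, `c t` is regular on `F(I) ⧸ (b t)` as soon as `c` is regular on the filtration of
`R ⧸ b` induced by `I`. -/
theorem mem_reesComponent_of_mul_mem {m : Ideal R} {x : R} {L : List R} (hIm : I ≤ m)
    (hb : b ≤ I) (hcI : c ∈ I) (hL : Ideal.ofList L ≤ I) (hxm : x ∈ m)
    (hmin : m * I ≤ Ideal.span {x} * I ⊔ (b ⊔ Ideal.span {c} ⊔ Ideal.ofList L) * m)
    (hx : ∀ p, x * p ∈ b → p ∈ b)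
    (hc : ∀ p, c * p ∈ b ⊔ Ideal.span {x} → p ∈ b ⊔ Ideal.span {x})
    (hreg : IsRegularMod (b ⊔ Ideal.span {x} ⊔ Ideal.span {c}) L)
    (hVV : ∀ n, b ⊓ I ^ n ≤ b * I ^ (n - 1))
    (hcreg : ∀ n p, c * p ∈ I ^ (n + 1) ⊔ b → p ∈ I ^ n ⊔ b)
    (n : ℕ) (w : R) (hw : w ∈ I ^ n) (hcw : c * w ∈ reesComponent m I b (n + 1)) :
    w ∈ reesComponent m I b n := by
  set Q := Ideal.ofList L with hQ
  set q := b ⊔ Ideal.span {c} ⊔ Q with hq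
  have hqI : q ≤ I := sup_le (sup_le hb ((Ideal.span_singleton_le_iff_mem _).2 hcI)) hL
  have hpow : ∀ k, m * I ^ (k + 1) ≤ Ideal.span {x} * I ^ (k + 1) ⊔ m * q ^ (k + 1) := by
    intro k
    induction k with
    | zero => simpa [mul_comm] using hmin
    | succ k ih =>
      calc m * I ^ (k + 1 + 1) = I * (m * I ^ (k + 1)) := by ring
        _ ≤ I * (Ideal.span {x} * I ^ (k + 1) ⊔ m * q ^ (k + 1)) := by gcongr
        _ = Ideal.span {x} * I ^ (k + 1 + 1) ⊔ q ^ (k + 1) * (m * I) := by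
          rw [Ideal.mul_sup]; congr 1 <;> ring
        _ ≤ Ideal.span {x} * I ^ (k + 1 + 1) ⊔ q ^ (k + 1) * (Ideal.span {x} * I ⊔ q * m) := by
          gcongr
        _ = Ideal.span {x} * I ^ (k + 1 + 1) ⊔
            (Ideal.span {x} * (q ^ (k + 1) * I) ⊔ m * q ^ (k + 1 + 1)) := by
          rw [Ideal.mul_sup]; congr 2 <;> ring
        _ ≤ _ := by
          refine sup_le le_sup_left (sup_le_sup_right ?_ _)
          rw [pow_succ I]
          gcongr
  have hmq : m * q ^ (n + 1) ≤ b ⊔ Ideal.span {c} * (m * q ^ n) ⊔ Q ^ (n + 1) := by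
    refine (Ideal.mul_mono_right (sup_pow_succ_le (b ⊔ Ideal.span {c}) Q n)).trans ?_
    rw [Ideal.mul_sup, ← hq, Ideal.sup_mul, Ideal.mul_sup]
    refine sup_le_sup (sup_le_sup ?_ (le_of_eq (by ring))) Ideal.mul_le_right
    exact Ideal.mul_le_right.trans Ideal.mul_le_left
  have hQm : Q ^ (n + 1) ≤ m * q ^ n := by
    rw [pow_succ']
    gcongr
    · exact hL.trans hIm
    · exact le_sup_right
  obtain ⟨s, hs, b₁, hb₁, h₁⟩ := Submodule.mem_sup.1 hcw
  obtain ⟨xu, hxu, z, hz, rfl⟩ := Submodule.mem_sup.1 (hpow n hs)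
  obtain ⟨u, hu, rfl⟩ := Ideal.mem_span_singleton_mul.1 hxu
  obtain ⟨bc, hbc, g, hg, rfl⟩ := Submodule.mem_sup.1 (hmq hz)
  obtain ⟨b₂, hb₂, cz, hcz, rfl⟩ := Submodule.mem_sup.1 hbc
  obtain ⟨z₁, hz₁, rfl⟩ := Ideal.mem_span_singleton_mul.1 hcz
  replace hb₁ := Ideal.mul_le_left hb₁
  -- the part `g` of the numerator in the remaining generators lies in `(b, x, c)`
  have hg' : g ∈ (b ⊔ Ideal.span {x} ⊔ Ideal.span {c}) * Q ^ (n + 1) := by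
    refine inf_pow_le_mul_pow_of_isRegularMod L _ hreg _ (Ideal.mem_inf.2 ⟨?_, hg⟩)
    refine mul_mem_sup_span_singleton.2 ⟨w - z₁, mul_mem_sup_span_singleton.2 ⟨-u, ?_⟩⟩
    convert b.neg_mem (b.add_mem hb₁ hb₂) using 1
    linear_combination h₁
  rw [Ideal.sup_mul, Ideal.sup_mul] at hg'
  obtain ⟨bx, hbx, cz', hcz', rfl⟩ := Submodule.mem_sup.1 hg'
  obtain ⟨b₃, hb₃, xz, hxz, rfl⟩ := Submodule.mem_sup.1 hbx
  obtain ⟨z₂, hz₂, rfl⟩ := Ideal.mem_span_singleton_mul.1 hxz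
  obtain ⟨z₃, hz₃, rfl⟩ := Ideal.mem_span_singleton_mul.1 hcz'
  replace hb₃ := Ideal.mul_le_left hb₃
  have hbsum : c * (w - z₁ - z₃) - x * (u + z₂) ∈ b := by
    convert b.add_mem hb₁ (b.add_mem hb₂ hb₃) using 1
    linear_combination -h₁
  obtain ⟨p, hp⟩ := mul_mem_sup_span_singleton.1 (hc _ (mul_mem_sup_span_singleton.2 ⟨_, hbsum⟩))
  have hcp : c * p - (u + z₂) ∈ b := by
    refine hx _ ?_
    convert b.sub_mem hbsum (b.mul_mem_left c hp) using 1
    ring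
  have hcp' : c * p ∈ I ^ (n + 1) ⊔ b := by
    rw [show c * p = (u + z₂) + (c * p - (u + z₂)) by ring]
    exact Submodule.add_mem_sup (Ideal.add_mem _ hu (Ideal.pow_right_mono hL _ hz₂)) hcp
  obtain ⟨p₁, hp₁, b₄, hb₄, rfl⟩ := Submodule.mem_sup.1 (hcreg n p hcp')
  have hmem : z₁ + z₃ + x * p₁ ∈ m * I ^ n := by
    refine Ideal.add_mem _ (Ideal.mul_mono_right (Ideal.pow_right_mono hqI n)
      (Ideal.add_mem _ hz₁ (hQm hz₃))) (Ideal.mul_mem_mul hxm hp₁)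
  have hrest : w - (z₁ + z₃ + x * p₁) ∈ b * I ^ (n - 1) := by
    refine hVV n (Ideal.mem_inf.2 ⟨?_, Ideal.sub_mem _ hw (Ideal.mul_le_right hmem)⟩)
    convert b.add_mem hp (b.mul_mem_left x hb₄) using 1
    ring
  rw [show w = (z₁ + z₃ + x * p₁) + (w - (z₁ + z₃ + x * p₁)) by ring]
  exact (Submodule.add_mem_sup hmem hrest : _ ∈ m * I ^ n ⊔ b * I ^ (n - 1))

end Components

/-! ### Regular sequences of degree one in `G(I)` and `F(I)` -/

section Rees

variable {R : Type*} [CommRing R] {I : Ideal R}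

theorem pow_mul_reesComponent_le {𝔞 b : Ideal R} (hb : b ≤ 𝔞) (i j : ℕ) :
    I ^ i * reesComponent 𝔞 I b j ≤ reesComponent 𝔞 I b (i + j) := by
  unfold reesComponent
  rw [Ideal.mul_sup]
  refine sup_le (le_sup_of_le_left (le_of_eq (by rw [pow_add]; ring))) ?_
  cases j with
  | zero =>
    refine le_sup_of_le_left ?_
    rw [mul_comm]
    simpa using Ideal.mul_mono_left hb
  | succ j =>
    refine le_sup_of_le_right (le_of_eq ?_)
    rw [← add_assoc, Nat.add_sub_cancel, Nat.add_sub_cancel, pow_add]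
    ring

/-- The homogeneous ideal of the Rees algebra `R[It]` with components `reesComponent 𝔞 I b`. -/
def reesIdeal (𝔞 b : Ideal R) (hb : b ≤ 𝔞) : Ideal (reesAlgebra I) where
  carrier := {f | ∀ n, (f : Polynomial R).coeff n ∈ reesComponent 𝔞 I b n}
  add_mem' hf hg n := by
    rw [Subalgebra.coe_add, Polynomial.coeff_add]
    exact Ideal.add_mem _ (hf n) (hg n)
  zero_mem' n := by simp
  smul_mem' g f hf n := by
    rw [smul_eq_mul, Subalgebra.coe_mul, Polynomial.coeff_mul]
    refine Ideal.sum_mem _ fun ⟨i, j⟩ hij => ?_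
    rw [← Finset.HasAntidiagonal.mem_antidiagonal.1 hij]
    exact pow_mul_reesComponent_le hb i j
      (Ideal.mul_mem_mul ((mem_reesAlgebra_iff I _).1 g.2 i) (hf j))

theorem map_sup_ofList_eq_reesIdeal (𝔞 : Ideal R) (L : List I)
    (hb : Ideal.ofList (L.map Subtype.val) ≤ 𝔞) :
    𝔞.map (algebraMap R (reesAlgebra I)) ⊔ Ideal.ofList (L.map reesDegreeOne) =
      reesIdeal 𝔞 (Ideal.ofList (L.map Subtype.val)) hb := by
  set K := 𝔞.map (algebraMap R (reesAlgebra I)) ⊔ Ideal.ofList (L.map reesDegreeOne) with hK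
  refine le_antisymm (sup_le (Ideal.map_le_iff_le_comap.2 fun r hr n => ?_)
    (Ideal.span_le.2 fun f hf n => ?_)) fun f hf => ?_
  · rw [Subalgebra.coe_algebraMap, Polynomial.algebraMap_apply, Algebra.algebraMap_self,
      RingHom.id_apply, Polynomial.coeff_C]
    split_ifs with h
    · subst h
      exact Ideal.mem_sup_left (by simpa using hr)
    · exact Ideal.zero_mem _
  · obtain ⟨a, ha, rfl⟩ := List.mem_map.1 hf
    simp only [reesDegreeOne, Polynomial.coeff_monomial]
    split_ifs with h
    · subst h
      refine Ideal.mem_sup_right ?_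
      have hmem : (a : R) ∈ Ideal.ofList (L.map Subtype.val) :=
        Ideal.subset_span (List.mem_map_of_mem ha)
      simpa using hmem
    · exact Ideal.zero_mem _
  · have hadd : ∀ (n : ℕ) (u v : R),
        (∃ g ∈ K, (g : Polynomial R) = Polynomial.monomial n u) →
        (∃ g ∈ K, (g : Polynomial R) = Polynomial.monomial n v) →
        ∃ g ∈ K, (g : Polynomial R) = Polynomial.monomial n (u + v) := by
      rintro n u v ⟨g, hg, hgu⟩ ⟨g', hg', hgv⟩
      exact ⟨g + g', K.add_mem hg hg', by simp [hgu, hgv]⟩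
    have h𝔞 : ∀ n, ∀ u ∈ 𝔞 * I ^ n, ∃ g ∈ K, (g : Polynomial R) = Polynomial.monomial n u := by
      intro n u hu
      refine Submodule.mul_induction_on hu (fun r hr s hs => ?_) (hadd n)
      exact ⟨algebraMap R (reesAlgebra I) r *
        ⟨Polynomial.monomial n s, reesAlgebra.monomial_mem.2 hs⟩,
        Ideal.mem_sup_left (Ideal.mul_mem_right _ _ (Ideal.mem_map_of_mem _ hr)),
        by simp [Polynomial.C_mul_monomial]⟩
    have hbm : ∀ n, ∀ u ∈ Ideal.ofList (L.map Subtype.val) * I ^ n,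
        ∃ g ∈ K, (g : Polynomial R) = Polynomial.monomial (n + 1) u := by
      intro n u hu
      refine Submodule.mul_induction_on hu (fun r hr s hs => ?_) (hadd (n + 1))
      refine Submodule.span_induction (p := fun r _ =>
        ∃ g ∈ K, (g : Polynomial R) = Polynomial.monomial (n + 1) (r * s)) ?_ ?_ ?_ ?_ hr
      · intro r hr
        obtain ⟨a, ha, rfl⟩ := List.mem_map.1 hr
        refine ⟨reesDegreeOne a * ⟨Polynomial.monomial n s, reesAlgebra.monomial_mem.2 hs⟩,
          Ideal.mem_sup_right (Ideal.mul_mem_right _ _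
            (Ideal.subset_span (List.mem_map_of_mem ha))), ?_⟩
        simp [reesDegreeOne, Polynomial.monomial_mul_monomial, add_comm]
      · exact ⟨0, K.zero_mem, by simp⟩
      · intro r r' _ _ h h'
        rw [add_mul]
        exact hadd _ _ _ h h'
      · rintro r r' _ ⟨g, hg, hgr⟩
        exact ⟨algebraMap R (reesAlgebra I) r * g, K.mul_mem_left _ hg,
          by simp [hgr, Polynomial.C_mul_monomial, mul_assoc]⟩
    have hcomp : ∀ n, ∀ u ∈ reesComponent 𝔞 I (Ideal.ofList (L.map Subtype.val)) n,
        ∃ g ∈ K, (g : Polynomial R) = Polynomial.monomial n u := by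
      intro n u hu
      obtain ⟨v, hv, w, hw, rfl⟩ := Submodule.mem_sup.1 hu
      refine hadd n v w (h𝔞 n v hv) ?_
      cases n with
      | zero => exact h𝔞 0 w (Ideal.mul_mono_left hb (by simpa using hw))
      | succ n => exact hbm n w (by simpa using hw)
    choose! g hgK hg using fun n => hcomp n _ (hf n)
    have : f = ∑ n ∈ (f : Polynomial R).support, g n := by
      ext1
      rw [AddSubmonoidClass.coe_finsetSum]
      simp only [hg]
      exact (f : Polynomial R).as_sum_support
    rw [this]
    exact K.sum_mem fun n _ => hgK n

theorem forall_reesDegreeOne_mul_mem_iff {𝔞 b : Ideal R} {hb : b ≤ 𝔞} (c : I) :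
    (∀ f : reesAlgebra I, reesDegreeOne c * f ∈ reesIdeal 𝔞 b hb → f ∈ reesIdeal 𝔞 b hb) ↔
      ∀ n, ∀ w ∈ I ^ n, (c : R) * w ∈ reesComponent 𝔞 I b (n + 1) → w ∈ reesComponent 𝔞 I b n := by
  constructor
  · intro h n w hw hcw
    have := h ⟨Polynomial.monomial n w, reesAlgebra.monomial_mem.2 hw⟩ (fun k => by
      simp only [reesDegreeOne, Subalgebra.coe_mul, Polynomial.monomial_mul_monomial,
        Polynomial.coeff_monomial]
      split_ifs with hk
      · rw [← hk, add_comm]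
        exact hcw
      · exact Ideal.zero_mem _) n
    simpa using this
  · intro h f hf n
    refine h n _ ((mem_reesAlgebra_iff I _).1 f.2 n) ?_
    have := hf (n + 1)
    change ((Polynomial.monomial 1 (c : R)) * (f : Polynomial R)).coeff (n + 1) ∈ _ at this
    rwa [Polynomial.coeff_monomial_mul] at this

/-- A sequence `a₁, …, a_t` in `I` whose initial forms are regular in `G(I)` is regular in `F(I)`,
if it extends to a sequence `a` such that `𝔪 I = x I + (a) 𝔪` and such that `x, a` is regular in
every order. The Valabrega-Valla equalities for `a₁, …, a_t` are carried along in the induction. -/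
theorem isRegularMod_fiberCone {m : Ideal R} {x : R} (hIm : I ≤ m) (hxm : x ∈ m) (L₁ : List I) :
    ∀ L₂ : List I,
    m * I ≤ Ideal.span {x} * I ⊔ Ideal.ofList ((L₁ ++ L₂).map Subtype.val) * m →
    (∀ L' : List R, L'.Perm (x :: (L₁ ++ L₂).map Subtype.val) → IsRegularMod ⊥ L') →
    IsRegularMod (I.map (algebraMap R (reesAlgebra I))) (L₁.map reesDegreeOne) →
    (∀ n, Ideal.ofList (L₁.map Subtype.val) ⊓ I ^ n ≤
      Ideal.ofList (L₁.map Subtype.val) * I ^ (n - 1)) ∧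
    IsRegularMod (m.map (algebraMap R (reesAlgebra I))) (L₁.map reesDegreeOne) := by
  have hofList : ∀ L : List I, Ideal.ofList (L.map Subtype.val) ≤ I := by
    intro L
    refine Ideal.span_le.2 fun r hr => ?_
    obtain ⟨a, _, rfl⟩ := List.mem_map.1 hr
    exact a.2
  induction L₁ using List.reverseRecOn with
  | nil => exact fun L₂ _ _ _ => ⟨fun n => by simp, trivial⟩
  | append_singleton L₁ c ih =>
    intro L₂ hmin hperm hreg
    rw [List.map_append, isRegularMod_append] at hreg
    obtain ⟨hreg₁, hc, -⟩ := hreg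
    rw [List.append_assoc] at hmin hperm
    obtain ⟨hVV, hF⟩ := ih ([c] ++ L₂) hmin hperm hreg₁
    rw [map_sup_ofList_eq_reesIdeal I L₁ (hofList L₁), forall_reesDegreeOne_mul_mem_iff] at hc
    have hcreg := mem_pow_sup_of_mul_mem c.2 hVV hc
    have hperm' := hperm (L₁.map Subtype.val ++ (x :: c.1 :: L₂.map Subtype.val)) (by
      simp only [List.map_append, List.map_cons, List.singleton_append]
      exact List.perm_middle)
    rw [isRegularMod_append, bot_sup_eq] at hperm'
    obtain ⟨-, hx, hcx, hL₂⟩ := hperm'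
    refine ⟨?_, ?_⟩
    · simpa using fun n => inf_pow_le_mul_pow_sup_span hVV c.2 hcreg n
    · rw [List.map_append, isRegularMod_append]
      refine ⟨hF, ?_, trivial⟩
      rw [map_sup_ofList_eq_reesIdeal m L₁ ((hofList L₁).trans hIm),
        forall_reesDegreeOne_mul_mem_iff]
      refine mem_reesComponent_of_mul_mem hIm (hofList L₁) c.2 (hofList L₂) hxm ?_ hx hcx hL₂ hVV
        hcreg
      simpa [sup_assoc] using hmin

end Rees

/-! ### The bigraded Rees algebra -/

section MultiRees

open Filter

variable {R : Type*} [CommRing R] (m I : Ideal R)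

/-- The product `𝔪 ^ r * I ^ s` for `g = (r, s)`. -/
def bipow (g : ℕ × ℕ) : Ideal R := m ^ g.1 * I ^ g.2

theorem bipow_add (g h : ℕ × ℕ) : bipow m I (g + h) = bipow m I g * bipow m I h := by
  simp only [bipow, Prod.fst_add, Prod.snd_add, pow_add]
  ring

theorem bipow_antitone : Antitone (bipow m I) := fun _ _ h =>
  Ideal.mul_mono (Ideal.pow_le_pow_right h.1) (Ideal.pow_le_pow_right h.2)

/-- The bigraded Rees algebra `⨁ 𝔪 ^ r I ^ s`, built as the Rees algebra of the extension of `I` to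
the Rees algebra of `𝔪`. -/
abbrev MultiRees : Type _ := reesAlgebra (I.map (algebraMap R (reesAlgebra m)))

variable {m I}

/-- The component of bidegree `g` of an element of the bigraded Rees algebra. -/
noncomputable def bicoeff (f : MultiRees m I) (g : ℕ × ℕ) : R :=
  (((f : Polynomial (reesAlgebra m)).coeff g.2 : reesAlgebra m) : Polynomial R).coeff g.1

theorem bicoeff_add (f f' : MultiRees m I) (g : ℕ × ℕ) :
    bicoeff (f + f') g = bicoeff f g + bicoeff f' g := by
  simp [bicoeff]

theorem bicoeff_zero (g : ℕ × ℕ) : bicoeff (0 : MultiRees m I) g = 0 := by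
  simp [bicoeff]

theorem bicoeff_mem (f : MultiRees m I) (g : ℕ × ℕ) : bicoeff f g ∈ bipow m I g := by
  have hf := (mem_reesAlgebra_iff _ _).1 f.2 g.2
  rw [← Ideal.map_pow] at hf
  have key : ∀ y ∈ (I ^ g.2).map (algebraMap R (reesAlgebra m)),
      ∀ r, (y : Polynomial R).coeff r ∈ m ^ r * I ^ g.2 := by
    intro y hy
    refine Submodule.span_induction ?_ (by simp) ?_ ?_ hy
    · rintro _ ⟨a, ha, rfl⟩ r
      rw [Subalgebra.coe_algebraMap, Polynomial.algebraMap_apply, Algebra.algebraMap_self,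
        RingHom.id_apply, Polynomial.coeff_C]
      split_ifs with h
      · subst h
        simpa using ha
      · exact Ideal.zero_mem _
    · intro y z _ _ hy hz r
      rw [Subalgebra.coe_add, Polynomial.coeff_add]
      exact Ideal.add_mem _ (hy r) (hz r)
    · intro c y _ hy r
      rw [smul_eq_mul, Subalgebra.coe_mul, Polynomial.coeff_mul]
      refine Ideal.sum_mem _ fun ⟨i, j⟩ hij => ?_
      rw [← Finset.HasAntidiagonal.mem_antidiagonal.1 hij, pow_add, mul_assoc]
      exact Ideal.mul_mem_mul ((mem_reesAlgebra_iff _ _).1 c.2 i) (hy j)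
  exact key _ hf _

/-- The homogeneous element of bidegree `g` of the bigraded Rees algebra defined by an element
of `𝔪 ^ r I ^ s`, where `g = (r, s)`. -/
noncomputable def bimonomial (g : ℕ × ℕ) : bipow m I g →ₗ[R] MultiRees m I where
  toFun u := ⟨Polynomial.monomial g.2 ⟨Polynomial.monomial g.1 (u : R),
      reesAlgebra.monomial_mem.2 (Ideal.mul_le_left u.2)⟩, by
    rw [reesAlgebra.monomial_mem, ← Ideal.map_pow]
    have key : ∀ v ∈ m ^ g.1 * I ^ g.2, ∃ y ∈ (I ^ g.2).map (algebraMap R (reesAlgebra m)),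
        (y : Polynomial R) = Polynomial.monomial g.1 v := by
      intro v hv
      refine Submodule.mul_induction_on hv (fun r hr s hs => ?_) ?_
      · refine ⟨⟨Polynomial.monomial g.1 r, reesAlgebra.monomial_mem.2 hr⟩ *
          algebraMap R (reesAlgebra m) s, Ideal.mul_mem_left _ _ (Ideal.mem_map_of_mem _ hs), ?_⟩
        simp [Polynomial.monomial_mul_C]
      · rintro v w ⟨y, hy, hyv⟩ ⟨z, hz, hzw⟩
        exact ⟨y + z, Ideal.add_mem _ hy hz, by simp [hyv, hzw]⟩
    obtain ⟨y, hy, hyu⟩ := key u u.2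
    convert hy
    exact hyu.symm⟩
  map_add' u v := by
    ext1
    ext i : 1
    ext1
    simp only [Subalgebra.coe_add, Polynomial.coeff_add, Polynomial.coeff_monomial]
    split_ifs <;> simp
  map_smul' r u := by
    ext1
    ext i : 1
    ext1
    simp only [Subalgebra.coe_smul, Polynomial.coeff_smul, Polynomial.coeff_monomial,
      RingHom.id_apply]
    split_ifs <;> simp [Polynomial.smul_monomial]

theorem bicoeff_bimonomial (g h : ℕ × ℕ) (u : bipow m I g) :
    bicoeff (bimonomial g u) h = if g = h then (u : R) else 0 := by
  obtain ⟨r, s⟩ := g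
  obtain ⟨r', s'⟩ := h
  simp only [bicoeff, bimonomial, LinearMap.coe_mk, AddHom.coe_mk, Polynomial.coeff_monomial,
    Prod.mk.injEq]
  split_ifs with h1 h2 h2 <;> simp_all [Polynomial.coeff_monomial]

theorem bicoeff_mul_mem {B : ℕ × ℕ → Ideal R} (hB : ∀ g h, bipow m I h * B g ≤ B (h + g))
    (f f' : MultiRees m I) (hf' : ∀ g, bicoeff f' g ∈ B g) (g : ℕ × ℕ) :
    bicoeff (f * f') g ∈ B g := by
  obtain ⟨r, s⟩ := g
  rw [bicoeff, Subalgebra.coe_mul, Polynomial.coeff_mul, AddSubmonoidClass.coe_finsetSum,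
    Polynomial.finsetSum_coeff]
  refine Ideal.sum_mem _ fun ⟨i, j⟩ hij => ?_
  rw [Subalgebra.coe_mul, Polynomial.coeff_mul]
  refine Ideal.sum_mem _ fun ⟨i', j'⟩ hij' => ?_
  have h := hB (j', j) (i', i) (Ideal.mul_mem_mul (bicoeff_mem f (i', i)) (hf' (j', j)))
  rw [Prod.mk_add_mk, Finset.HasAntidiagonal.mem_antidiagonal.1 hij,
    Finset.HasAntidiagonal.mem_antidiagonal.1 hij'] at h
  exact h

theorem bicoeff_bimonomial_mul (h g : ℕ × ℕ) (z : bipow m I h) (f : MultiRees m I) :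
    bicoeff (bimonomial h z * f) (h + g) = z * bicoeff f g := by
  obtain ⟨r, s⟩ := g
  obtain ⟨r', s'⟩ := h
  simp only [bicoeff, bimonomial, LinearMap.coe_mk, AddHom.coe_mk, Subalgebra.coe_mul,
    Prod.mk_add_mk]
  rw [add_comm s' s, Polynomial.coeff_monomial_mul, Subalgebra.coe_mul, add_comm r' r,
    Polynomial.coeff_monomial_mul]

theorem bimonomial_mul (h g : ℕ × ℕ) (z : bipow m I h) (u : bipow m I g) :
    bimonomial h z * bimonomial g u = bimonomial (h + g)
      ⟨(z : R) * u, by rw [bipow_add]; exact Ideal.mul_mem_mul z.2 u.2⟩ := by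
  ext1
  simp only [bimonomial, LinearMap.coe_mk, AddHom.coe_mk, Subalgebra.coe_mul,
    Polynomial.monomial_mul_monomial, Prod.snd_add]
  congr 1
  ext1
  simp only [Subalgebra.coe_mul, Polynomial.monomial_mul_monomial, Prod.fst_add]

variable (m I) in
/-- The family `A` of ideals of `R` consists of the components of a bihomogeneous ideal of the
bigraded Rees algebra. -/
structure IsBigraded (A : ℕ × ℕ → Ideal R) : Prop where
  le : ∀ g, A g ≤ bipow m I g
  mul_le : ∀ g h, bipow m I h * A g ≤ A (h + g)

/-- The bihomogeneous ideal of the bigraded Rees algebra with the given components. -/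
def bigradedIdeal (B : ℕ × ℕ → Ideal R) (hB : ∀ g h, bipow m I h * B g ≤ B (h + g)) :
    Ideal (MultiRees m I) where
  carrier := {f | ∀ g, bicoeff f g ∈ B g}
  add_mem' hf hf' g := by
    rw [bicoeff_add]
    exact Ideal.add_mem _ (hf g) (hf' g)
  zero_mem' g := by
    rw [bicoeff_zero]
    exact Ideal.zero_mem _
  smul_mem' f f' hf' g := bicoeff_mul_mem hB f f' hf' g

theorem mem_bigradedIdeal {B : ℕ × ℕ → Ideal R} {hB : ∀ g h, bipow m I h * B g ≤ B (h + g)}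
    {f : MultiRees m I} : f ∈ bigradedIdeal B hB ↔ ∀ g, bicoeff f g ∈ B g := Iff.rfl

theorem bimonomial_mem_bigradedIdeal {B : ℕ × ℕ → Ideal R}
    {hB : ∀ g h, bipow m I h * B g ≤ B (h + g)} {g : ℕ × ℕ} {u : bipow m I g} :
    bimonomial g u ∈ bigradedIdeal B hB ↔ (u : R) ∈ B g := by
  rw [mem_bigradedIdeal]
  constructor
  · intro h
    simpa [bicoeff_bimonomial] using h g
  · intro h g'
    rw [bicoeff_bimonomial]
    split_ifs with hg
    · exact hg ▸ h
    · exact Ideal.zero_mem _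

theorem exists_forall_le_of_bicoeff_ne_zero (f : MultiRees m I) :
    ∃ N : ℕ × ℕ, ∀ g, bicoeff f g ≠ 0 → g ≤ N := by
  refine ⟨(((f : Polynomial (reesAlgebra m)).support.sup fun s =>
    (((f : Polynomial (reesAlgebra m)).coeff s : reesAlgebra m) : Polynomial R).natDegree),
    (f : Polynomial (reesAlgebra m)).natDegree), fun g hg => ?_⟩
  have h2 : (f : Polynomial (reesAlgebra m)).coeff g.2 ≠ 0 := by
    intro h
    rw [bicoeff, h] at hg
    simp at hg
  refine ⟨?_, Polynomial.le_natDegree_of_ne_zero h2⟩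
  exact (Polynomial.le_natDegree_of_ne_zero hg).trans (Finset.le_sup (f := fun s =>
    (((f : Polynomial (reesAlgebra m)).coeff s : reesAlgebra m) : Polynomial R).natDegree)
    (Polynomial.mem_support_iff.2 h2))

/-- Bihomogeneous ideals are finitely generated: the components of large bidegree come from those
of bidegree at most `N`. -/
theorem IsBigraded.exists_le_iSup [IsNoetherianRing R] {A : ℕ × ℕ → Ideal R}
    (hA : IsBigraded m I A) :
    ∃ N : ℕ × ℕ, ∀ g, A g ≤ ⨆ p : {p // p ≤ N ∧ p ≤ g}, bipow m I (g - p.1) * A p.1 := by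
  classical
  obtain ⟨S, hS⟩ := (IsNoetherian.noetherian (bigradedIdeal A hA.mul_le) : Submodule.FG _)
  choose N hN using exists_forall_le_of_bicoeff_ne_zero (m := m) (I := I)
  have hB : ∀ g h, bipow m I h *
      (⨆ p : {p // p ≤ S.sup N ∧ p ≤ g}, bipow m I (g - p.1) * A p.1) ≤
      ⨆ p : {p // p ≤ S.sup N ∧ p ≤ h + g}, bipow m I (h + g - p.1) * A p.1 := by
    intro g h
    rw [Ideal.mul_iSup]
    refine iSup_le fun p => ?_
    refine le_iSup_of_le ⟨p.1, p.2.1, p.2.2.trans le_add_self⟩ ?_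
    rw [← mul_assoc, ← bipow_add, add_tsub_assoc_of_le p.2.2]
  refine ⟨S.sup N, fun g u hu => ?_⟩
  have hle : bigradedIdeal A hA.mul_le ≤ bigradedIdeal _ hB := by
    rw [← hS]
    refine Submodule.span_le.2 fun f hf g => ?_
    by_cases h0 : bicoeff f g = 0
    · rw [h0]
      exact Ideal.zero_mem _
    · have hfA : bicoeff f g ∈ A g := by
        have : f ∈ bigradedIdeal A hA.mul_le := hS ▸ Submodule.subset_span hf
        exact this g
      refine Submodule.mem_iSup_of_mem (⟨g, (hN f g h0).trans (Finset.le_sup hf), le_rfl⟩ :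
        {p // p ≤ S.sup N ∧ p ≤ g}) ?_
      simpa [bipow] using hfA
  exact bimonomial_mem_bigradedIdeal.1 (hle (bimonomial_mem_bigradedIdeal (u := ⟨u, hA.le g hu⟩).2
    hu))

/-- If `A ⧸ C` is killed by all elements of large bidegree, it vanishes in large bidegree. -/
theorem IsBigraded.eventually_le [IsNoetherianRing R] {A C : ℕ × ℕ → Ideal R}
    (hA : IsBigraded m I A) (h : ∀ᶠ h in atTop, ∀ g, bipow m I h * A g ≤ C (h + g)) :
    ∀ᶠ g in atTop, A g ≤ C g := by
  obtain ⟨N, hN⟩ := hA.exists_le_iSup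
  obtain ⟨h₀, hh₀⟩ := eventually_atTop.1 h
  filter_upwards [eventually_ge_atTop (h₀ + N)] with g hg
  refine (hN g).trans (iSup_le fun p => ?_)
  have := hh₀ (g - p.1) (le_tsub_of_add_le_right ((add_le_add_right p.2.1 h₀).trans hg)) p.1
  rwa [tsub_add_cancel_of_le p.2.2] at this

end MultiRees

/-! ### General elements -/

section GeneralElements

open Filter

variable {R : Type*} [CommRing R]

/-- A finitely generated module over a local ring with infinite residue field is not a finite union
of proper submodules. -/
theorem exists_notMem_of_finite_of_ne_top [IsLocalRing R] [Infinite (ResidueField R)]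
    {M : Type*} [AddCommGroup M] [Module R M] [Module.Finite R M] {F : Set (Submodule R M)}
    (hF : F.Finite) (hne : ∀ N ∈ F, N ≠ ⊤) : ∃ z : M, ∀ N ∈ F, z ∉ N := by
  by_contra! hcon
  -- enlarging each submodule by `𝔪 M` keeps it proper, by Nakayama's lemma
  let p : Submodule R M → Submodule R M := fun N => N ⊔ maximalIdeal R • ⊤
  have hp : ∀ N ∈ F, p N ≠ ⊤ := by
    intro N hN htop
    refine hne N hN (top_le_iff.1 ?_)
    exact Submodule.le_of_le_smul_of_le_jacobson_bot (Module.finite_def.1 inferInstance)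
      (IsLocalRing.maximalIdeal_le_jacobson ⊥) htop.ge
  have hcover : ⋃ N ∈ hF.toFinset, (p N : Set M) = Set.univ := by
    refine Set.eq_univ_of_forall fun z => ?_
    obtain ⟨N, hN, hz⟩ := hcon z
    simp only [Set.mem_iUnion]
    exact ⟨N, hF.mem_toFinset.2 hN, Submodule.mem_sup_left hz⟩
  obtain ⟨N, hN, hfin⟩ := Submodule.exists_finiteIndex_of_cover hcover
  have hfinite : Finite (M ⧸ p N) := AddSubgroup.finite_quotient_of_finiteIndex
  obtain ⟨u, hu⟩ : ∃ u, u ∉ p N := by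
    by_contra! h
    exact hp N (hF.mem_toFinset.1 hN) (Submodule.eq_top_iff'.2 h)
  choose lift hlift using residue_surjective (R := R)
  refine not_injective_infinite_finite
    (fun k : ResidueField R => (p N).mkQ (lift k • u)) fun k k' hkk => ?_
  by_contra hne
  have hunit : IsUnit (lift k - lift k') := by
    rw [← residue_ne_zero_iff_isUnit, map_sub, hlift, hlift]
    exact sub_ne_zero.2 hne
  refine hu ((Submodule.smul_mem_iff_of_isUnit (p N) hunit).1 ?_)
  rw [sub_smul]
  exact (Submodule.Quotient.eq _).1 hkk

/-- Prime avoidance in linear form: if no element outside `J` is multiplied into `J` by the image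
of `φ`, then `φ z` is a nonzerodivisor modulo `J` for general `z`. -/
theorem exists_finite_regular {T M : Type*} [CommRing T] [IsNoetherianRing T] [Algebra R T]
    [AddCommGroup M] [Module R M] (φ : M →ₗ[R] T) (J : Ideal T)
    (h : ∀ u, (∀ z, φ z * u ∈ J) → u ∈ J) :
    ∃ F : Set (Submodule R M), F.Finite ∧ (∀ N ∈ F, N ≠ ⊤) ∧
      ∀ z, (∀ N ∈ F, z ∉ N) → ∀ y, φ z * y ∈ J → y ∈ J := by
  refine ⟨(fun P : Ideal T => (P.restrictScalars R).comap φ) '' associatedPrimes T (T ⧸ J),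
    (associatedPrimes.finite T (T ⧸ J)).image _, ?_, fun z hz =>
    mem_of_mul_mem_of_notMem_associatedPrimes fun P hP hzP => hz _ ⟨P, hP, rfl⟩ hzP⟩
  rintro _ ⟨P, hP, rfl⟩ htop
  obtain ⟨hp, u, hu⟩ := mem_associatedPrimes_quotient_iff.1 hP
  refine hp.ne_top ((Ideal.eq_top_iff_one _).2 ((hu 1).2 ?_))
  rw [one_mul]
  refine h u fun z => (hu _).1 ?_
  have : z ∈ (P.restrictScalars R).comap φ := (Submodule.eq_top_iff'.1 htop) z
  exact this

variable {m I : Ideal R}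

theorem mul_bicoeff_mem_of_pow_mul_mem {C : ℕ × ℕ → Ideal R} (hC : IsBigraded m I C)
    (h : ℕ × ℕ) (k : ℕ) : ∀ f : MultiRees m I,
    (∀ s ∈ Ideal.span (Set.range (bimonomial (m := m) (I := I) h)) ^ k,
      s * f ∈ bigradedIdeal C hC.mul_le) →
    ∀ g, ∀ v ∈ bipow m I h ^ k, v * bicoeff f g ∈ C (k • h + g) := by
  induction k with
  | zero =>
    intro f hf g v _
    have := hf 1 (by simp)
    rw [one_mul] at this
    simpa using Ideal.mul_mem_left _ v (this g)
  | succ k ih =>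
    intro f hf g v hv
    rw [pow_succ] at hv
    refine Submodule.mul_induction_on hv (fun v₂ hv₂ v₁ hv₁ => ?_) fun u w hu hw => ?_
    · have h1 := ih (bimonomial h ⟨v₁, hv₁⟩ * f) (fun s hs => by
        rw [← mul_assoc]
        refine hf _ ?_
        rw [pow_succ]
        exact Ideal.mul_mem_mul hs (Ideal.subset_span ⟨_, rfl⟩)) (h + g) v₂ hv₂
      rw [bicoeff_bimonomial_mul, ← mul_assoc, ← add_assoc, ← succ_nsmul] at h1
      exact h1
    · rw [add_mul]
      exact Ideal.add_mem _ hu hw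

/-- General elements of bidegree `h` are filter-regular: multiplication by `z` is injective on the
components of large bidegree of the bigraded Rees algebra modulo `C`. -/
theorem exists_finite_filterRegular [IsNoetherianRing R] {C : ℕ × ℕ → Ideal R}
    (hC : IsBigraded m I C) (h : ℕ × ℕ) :
    ∃ F : Set (Submodule R (bipow m I h)), F.Finite ∧ (∀ N ∈ F, N ≠ ⊤) ∧
      ∀ z : bipow m I h, (∀ N ∈ F, z ∉ N) →
        ∀ᶠ g in atTop, ∀ u ∈ bipow m I g, (z : R) * u ∈ C (h + g) → u ∈ C g := by
  set H := Ideal.span (Set.range (bimonomial (m := m) (I := I) h)) with hH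
  set D := bigradedIdeal C hC.mul_le with hD
  -- the saturation of `C` with respect to `H`
  have hmono : Monotone fun k : ℕ => Submodule.colon D ((H ^ k : Ideal _) : Set (MultiRees m I)) :=
    fun k k' hk => Submodule.colon_mono le_rfl (Ideal.pow_le_pow_right hk)
  obtain ⟨k, hk⟩ := monotone_stabilizes_iff_noetherian.2 (inferInstance :
    IsNoetherian (MultiRees m I) (MultiRees m I)) ⟨_, hmono⟩
  have hk' : Submodule.colon D ((H ^ k : Ideal _) : Set (MultiRees m I)) =
      Submodule.colon D ((H ^ (k + 1) : Ideal _) : Set (MultiRees m I)) := hk (k + 1) k.le_succ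
  obtain ⟨F, hF, hne, hreg⟩ := exists_finite_regular (bimonomial (m := m) (I := I) h)
    (Submodule.colon D ((H ^ k : Ideal _) : Set (MultiRees m I))) (by
      intro u hu
      rw [hk', Submodule.mem_colon]
      intro s hs
      rw [SetLike.mem_coe, pow_succ] at hs
      refine Submodule.mul_induction_on hs (fun s₂ hs₂ s₁ hs₁ => ?_) fun s s' hs hs' => ?_
      · refine Submodule.span_induction (p := fun s₁ _ => u • (s₂ * s₁) ∈ D) ?_ ?_ ?_ ?_ hs₁
        · rintro _ ⟨z, rfl⟩
          have := Submodule.mem_colon.1 (hu z) s₂ hs₂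
          convert this using 1
          simp only [smul_eq_mul]
          ring
        · simp
        · intro s s' _ _ hs hs'
          rw [mul_add, smul_add]
          exact D.add_mem hs hs'
        · intro a s _ hs
          convert D.mul_mem_left a hs using 1
          simp only [smul_eq_mul]
          ring
      · rw [smul_add]
        exact D.add_mem hs hs')
  refine ⟨F, hF, hne, fun z hz => ?_⟩
  let A : ℕ × ℕ → Ideal R := fun g =>
    bipow m I g ⊓ Submodule.comap (LinearMap.mulLeft R (z : R)) (C (h + g))
  have hA : IsBigraded m I A := by
    refine ⟨fun g => inf_le_left, fun g g' => Ideal.mul_le.2 fun v hv u hu => ?_⟩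
    obtain ⟨hu₁, hu₂⟩ := Submodule.mem_inf.1 hu
    refine Submodule.mem_inf.2 ⟨?_, ?_⟩
    · rw [bipow_add]
      exact Ideal.mul_mem_mul hv hu₁
    · have := hC.mul_le (h + g) g' (Ideal.mul_mem_mul hv hu₂)
      rw [Submodule.mem_comap, add_left_comm]
      convert this using 1
      simp only [LinearMap.mulLeft_apply]
      ring
  have hkill : ∀ᶠ g' in atTop, ∀ g, bipow m I g' * A g ≤ C (g' + g) := by
    filter_upwards [eventually_ge_atTop (k • h)] with g' hg' g
    have hpow : bipow m I h ^ k = bipow m I (k • h) := by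
      simp only [bipow, mul_pow, Prod.smul_fst, Prod.smul_snd, smul_eq_mul]
      rw [← pow_mul, ← pow_mul, mul_comm h.1, mul_comm h.2]
    obtain ⟨d, rfl⟩ := exists_add_of_le hg'
    have hmain : bipow m I (k • h) * A g ≤ C (k • h + g) := by
      rw [← hpow]
      refine Ideal.mul_le.2 fun v hv u hu => ?_
      obtain ⟨hu₁, hu₂⟩ := Submodule.mem_inf.1 hu
      have hmem := hreg z hz (bimonomial g ⟨u, hu₁⟩) (by
        rw [Submodule.mem_colon]
        intro s _
        rw [smul_eq_mul, mul_comm]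
        rw [bimonomial_mul]
        exact Ideal.mul_mem_left _ _ (bimonomial_mem_bigradedIdeal.2 hu₂))
      have h3 := mul_bicoeff_mem_of_pow_mul_mem hC h k (bimonomial g ⟨u, hu₁⟩) (fun s hs => by
        have := Submodule.mem_colon.1 hmem s hs
        rwa [smul_eq_mul, mul_comm] at this) g v hv
      rwa [bicoeff_bimonomial, if_pos rfl] at h3
    rw [bipow_add, mul_comm (bipow m I (k • h)), mul_assoc, add_comm (k • h), add_assoc]
    exact (Ideal.mul_mono_right hmain).trans (hC.mul_le _ _)
  filter_upwards [hA.eventually_le hkill] with g hg u hu hzu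
  exact hg (Submodule.mem_inf.2 ⟨hu, hzu⟩)

end GeneralElements

/-! ### Lengths and difference operators -/

section Length

variable {R : Type*} [CommRing R]

/-- The length of `A ⧸ A ⊓ C`. -/
noncomputable def relLength (A C : Ideal R) : ℕ∞ := Module.length R (A ⧸ C.submoduleOf A)

/-- The length of `A ⧸ A ⊓ C` as an integer, with value `0` if the length is infinite. -/
noncomputable def relLengthInt (A C : Ideal R) : ℤ := (relLength A C).toNat

theorem relLength_top (C : Ideal R) : relLength ⊤ C = Module.length R (R ⧸ C) :=
  (Submodule.Quotient.equiv (C.submoduleOf ⊤) C Submodule.topEquiv (by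
    ext x
    simp [Submodule.submoduleOf])).length_eq

theorem relLength_add {A B C : Ideal R} (hCB : C ≤ B) (hBA : B ≤ A) :
    relLength A C = relLength B C + relLength A B := by
  have hf : C.submoduleOf B ≤ Submodule.comap (Submodule.inclusion hBA) (C.submoduleOf A) :=
    fun x hx => hx
  have hg : C.submoduleOf A ≤ Submodule.comap LinearMap.id (B.submoduleOf A) := fun x hx => hCB hx
  refine Module.length_eq_add_of_exact (Submodule.mapQ _ _ _ hf) (Submodule.mapQ _ _ _ hg) ?_ ?_ ?_
  · rw [← LinearMap.ker_eq_bot, eq_bot_iff]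
    intro x hx
    obtain ⟨x, rfl⟩ := Submodule.Quotient.mk_surjective _ x
    rw [LinearMap.mem_ker, Submodule.mapQ_apply, Submodule.Quotient.mk_eq_zero] at hx
    exact (Submodule.Quotient.mk_eq_zero _).2 hx
  · intro x
    obtain ⟨x, rfl⟩ := Submodule.Quotient.mk_surjective _ x
    exact ⟨Submodule.Quotient.mk x, rfl⟩
  · intro x
    obtain ⟨x, rfl⟩ := Submodule.Quotient.mk_surjective _ x
    rw [Submodule.mapQ_apply, Submodule.Quotient.mk_eq_zero]
    constructor
    · intro hx
      exact ⟨Submodule.Quotient.mk ⟨x.1, hx⟩, rfl⟩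
    · rintro ⟨y, hy⟩
      obtain ⟨y, rfl⟩ := Submodule.Quotient.mk_surjective _ y
      rw [Submodule.mapQ_apply] at hy
      have h1 := (Submodule.Quotient.eq _).1 hy
      have h2 : (y : R) - x ∈ C := h1
      have h3 := B.sub_mem y.2 (hCB h2)
      simpa [Submodule.submoduleOf] using h3

/-- Multiplication by `z` identifies `A ⧸ (A ⊓ (C : z))` with `(C + z A) ⧸ C`. -/
theorem relLength_sup_span_mul (A C : Ideal R) (z : R) :
    relLength (C ⊔ Ideal.span {z} * A) C =
      relLength A (A ⊓ Submodule.comap (LinearMap.mulLeft R z) C) := by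
  let f₀ : A →ₗ[R] (C ⊔ Ideal.span {z} * A : Ideal R) :=
    LinearMap.codRestrict _ ((LinearMap.mulLeft R z).comp A.subtype) fun a =>
      Ideal.mem_sup_right (Ideal.mul_mem_mul (Ideal.mem_span_singleton_self z) a.2)
  let f := (C.submoduleOf (C ⊔ Ideal.span {z} * A)).mkQ.comp f₀
  have hf : Function.Surjective f := by
    intro y
    obtain ⟨⟨y, hy⟩, rfl⟩ := Submodule.Quotient.mk_surjective _ y
    obtain ⟨c, hc, w, hw, rfl⟩ := Submodule.mem_sup.1 hy
    obtain ⟨a, ha, rfl⟩ := Ideal.mem_span_singleton_mul.1 hw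
    refine ⟨⟨a, ha⟩, (Submodule.Quotient.eq _).2 ?_⟩
    change z * a - (c + z * a) ∈ C
    simpa using hc
  have hker : LinearMap.ker f =
      (A ⊓ Submodule.comap (LinearMap.mulLeft R z) C).submoduleOf A := by
    ext a
    rw [LinearMap.mem_ker]
    change Submodule.Quotient.mk (f₀ a) = 0 ↔ _
    rw [Submodule.Quotient.mk_eq_zero]
    change z * a.1 ∈ C ↔ a.1 ∈ A ⊓ Submodule.comap (LinearMap.mulLeft R z) C
    rw [Submodule.mem_inf]
    exact ⟨fun h => ⟨a.2, h⟩, fun h => h.2⟩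
  unfold relLength
  rw [← hker]
  exact (f.quotKerEquivOfSurjective hf).length_eq.symm

theorem relLength_sup_eq (A C : Ideal R) : relLength (C ⊔ A) C = relLength A (A ⊓ C) := by
  have := relLength_sup_span_mul A C 1
  simp only [Ideal.span_singleton_one, Ideal.top_mul] at this
  rw [this]
  congr 2
  ext x
  simp

theorem relLength_le_of_le {A B C : Ideal R} (hCB : C ≤ B) (hBA : B ≤ A) :
    relLength A B ≤ relLength A C := by
  rw [relLength_add hCB hBA]
  exact le_add_self

theorem relLength_mono_left {A B C : Ideal R} (hCB : C ≤ B) (hBA : B ≤ A) :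
    relLength B C ≤ relLength A C := by
  rw [relLength_add hCB hBA]
  exact le_self_add

theorem relLength_eq_zero_iff {A C : Ideal R} : relLength A C = 0 ↔ A ≤ C := by
  rw [relLength, Module.length_eq_zero_iff, Submodule.Quotient.subsingleton_iff,
    Submodule.submoduleOf_eq_top]

theorem relLengthInt_add {A B C : Ideal R} (hCB : C ≤ B) (hBA : B ≤ A) (h : relLength A C ≠ ⊤) :
    relLengthInt A C = relLengthInt B C + relLengthInt A B := by
  have hadd := relLength_add hCB hBA
  rw [hadd] at h
  obtain ⟨h1, h2⟩ := WithTop.add_ne_top.1 h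
  unfold relLengthInt
  rw [hadd, ENat.toNat_add h1 h2]
  push_cast
  rfl

/-- The alternating sum of lengths in the exact sequence
`0 → K ⧸ C₁ → A₁ ⧸ C₁ → A₂ ⧸ C₂ → A₂ ⧸ (C₂ + z A₁) → 0`, where `K` is the preimage of `C₂` under
multiplication by `z`. -/
theorem relLengthInt_sub_eq {A₁ A₂ C₁ C₂ : Ideal R} {z : R} (h₁ : C₁ ≤ A₁) (h₂ : C₂ ≤ A₂)
    (hA : Ideal.span {z} * A₁ ≤ A₂) (hC : Ideal.span {z} * C₁ ≤ C₂)
    (hfin₁ : relLength A₁ C₁ ≠ ⊤) (hfin₂ : relLength A₂ C₂ ≠ ⊤) :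
    relLengthInt A₂ C₂ - relLengthInt A₁ C₁ =
      relLengthInt A₂ (C₂ ⊔ Ideal.span {z} * A₁) -
        relLengthInt (A₁ ⊓ Submodule.comap (LinearMap.mulLeft R z) C₂) C₁ := by
  have hCK : C₁ ≤ A₁ ⊓ Submodule.comap (LinearMap.mulLeft R z) C₂ :=
    le_inf h₁ fun u hu => hC (Ideal.mul_mem_mul (Ideal.mem_span_singleton_self z) hu)
  rw [relLengthInt_add le_sup_left (sup_le h₂ hA) hfin₂, relLengthInt_add hCK inf_le_left hfin₁]
  have : relLengthInt (C₂ ⊔ Ideal.span {z} * A₁) C₂ =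
      relLengthInt A₁ (A₁ ⊓ Submodule.comap (LinearMap.mulLeft R z) C₂) := by
    rw [relLengthInt, relLengthInt, relLength_sup_span_mul]
  rw [this]
  ring

end Length

section Differences

open Filter

/-- The backward difference operator in direction `h`. The subtraction in `ℕ × ℕ` truncates, so only
the values at `g ≥ h` are meaningful; statements about it concern large `g`. -/
def nabla (h : ℕ × ℕ) (f : ℕ × ℕ → ℤ) : ℕ × ℕ → ℤ := fun g => f g - f (g - h)

/-- The composition of the backward difference operators in the directions of the list. -/
def iterNabla : List (ℕ × ℕ) → (ℕ × ℕ → ℤ) → ℕ × ℕ → ℤ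
  | [], f => f
  | h :: hs, f => iterNabla hs (nabla h f)

theorem tendsto_sub_atTop (h : ℕ × ℕ) : Tendsto (fun g : ℕ × ℕ => g - h) atTop atTop := by
  refine tendsto_atTop.2 fun b => ?_
  filter_upwards [eventually_ge_atTop (b + h)] with g hg
  exact le_tsub_of_add_le_right hg

theorem iterNabla_congr (hs : List (ℕ × ℕ)) : ∀ {f f' : ℕ × ℕ → ℤ}, f =ᶠ[atTop] f' →
    iterNabla hs f =ᶠ[atTop] iterNabla hs f' := by
  induction hs with
  | nil => exact fun h => h
  | cons h hs ih =>
    intro f f' hff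
    exact ih (hff.sub (hff.comp_tendsto (tendsto_sub_atTop h)))

theorem iterNabla_sub (hs : List (ℕ × ℕ)) : ∀ f f' : ℕ × ℕ → ℤ,
    iterNabla hs (f - f') = iterNabla hs f - iterNabla hs f' := by
  induction hs with
  | nil => exact fun _ _ => rfl
  | cons h hs ih =>
    intro f f'
    rw [iterNabla, iterNabla, iterNabla, ← ih]
    congr 1
    funext g
    simp only [nabla, Pi.sub_apply]
    ring

theorem iterNabla_shift (hs : List (ℕ × ℕ)) (h : ℕ × ℕ) : ∀ f : ℕ × ℕ → ℤ,
    iterNabla hs (fun g => f (g - h)) = fun g => iterNabla hs f (g - h) := by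
  induction hs with
  | nil => exact fun _ => rfl
  | cons h' hs ih =>
    intro f
    rw [iterNabla, iterNabla, ← ih]
    congr 1
    funext g
    simp only [nabla, tsub_right_comm]

end Differences

/-! ### Joint reductions and the mixed multiplicity -/

section JointReduction

open Filter

variable {R : Type*} [CommRing R] {m I : Ideal R}

variable (m I) in
/-- The elements `z.2` of `𝔪 ^ r I ^ s`, where `z.1 = (r, s)`, generate the components of large
bidegree of the bigraded Rees algebra. -/
structure IsEventualReduction (zs : List ((ℕ × ℕ) × R)) : Prop where
  mem : ∀ z ∈ zs, z.2 ∈ bipow m I z.1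
  eventually_le : ∀ᶠ g in atTop, bipow m I g ≤ ⨆ z ∈ zs, Ideal.span {z.2} * bipow m I (g - z.1)

theorem bipow_mul_le_of_le {A : ℕ × ℕ → Ideal R} (hA : ∀ g h, bipow m I h * A g ≤ A (h + g))
    {g g' h : ℕ × ℕ} (hgg' : g ≤ g') (hg' : g' ≤ h + g) : bipow m I h * A g ≤ A g' := by
  obtain ⟨k, rfl⟩ := exists_add_of_le hgg'
  rw [add_comm g k]
  exact (Ideal.mul_mono_left (bipow_antitone m I
    (le_of_add_le_add_right (by rwa [add_comm k g])))).trans (hA g k)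

theorem span_mul_le_of_le {A : ℕ × ℕ → Ideal R} (hA : ∀ g h, bipow m I h * A g ≤ A (h + g))
    {g h : ℕ × ℕ} {z : R} (hz : z ∈ bipow m I h) : Ideal.span {z} * A (g - h) ≤ A g :=
  (Ideal.mul_mono_left ((Ideal.span_singleton_le_iff_mem _).2 hz)).trans
    (bipow_mul_le_of_le hA tsub_le_self le_add_tsub)

theorem mul_sub_le {A : ℕ × ℕ → Ideal R} (hA : ∀ g h, bipow m I h * A g ≤ A (h + g))
    (g h k : ℕ × ℕ) : bipow m I k * A (g - h) ≤ A (k + g - h) :=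
  bipow_mul_le_of_le hA (tsub_le_tsub_right le_add_self h) add_tsub_le_assoc

theorem IsBigraded.sup_span_mul {A C : ℕ × ℕ → Ideal R} (hA : IsBigraded m I A)
    (hC : IsBigraded m I C) {h : ℕ × ℕ} {z : R} (hz : z ∈ bipow m I h) :
    IsBigraded m I fun g => C g ⊔ Ideal.span {z} * A (g - h) := by
  refine ⟨fun g => sup_le (hC.le g) ((span_mul_le_of_le hA.mul_le hz).trans (hA.le g)),
    fun g k => ?_⟩
  rw [Ideal.mul_sup, mul_left_comm]
  exact sup_le_sup (hC.mul_le g k) (Ideal.mul_mono_right (mul_sub_le hA.mul_le g h k))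

theorem IsBigraded.inf_comap {A C : ℕ × ℕ → Ideal R} (hA : IsBigraded m I A)
    (hC : IsBigraded m I C) (h : ℕ × ℕ) (z : R) :
    IsBigraded m I fun g => A g ⊓ Submodule.comap (LinearMap.mulLeft R z) (C (h + g)) := by
  refine ⟨fun g => inf_le_left.trans (hA.le g), fun g k => Ideal.mul_le.2 fun v hv u hu => ?_⟩
  obtain ⟨hu₁, hu₂⟩ := Submodule.mem_inf.1 hu
  refine Submodule.mem_inf.2 ⟨hA.mul_le g k (Ideal.mul_mem_mul hv hu₁), ?_⟩
  have := hC.mul_le (h + g) k (Ideal.mul_mem_mul hv hu₂)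
  rw [Submodule.mem_comap, add_left_comm]
  convert this using 1
  simp only [LinearMap.mulLeft_apply]
  ring

variable [IsNoetherianRing R]

/-- The Euler characteristic of the Koszul complex of a joint reduction on a finitely generated
bigraded module vanishes in large bidegree, since its homology is killed by the joint reduction.
Here the module is `A ⧸ C`, it is killed by the elements of `done`, and the Euler characteristic is
written as an iterated difference in the degrees of the remaining elements. -/
theorem iterNabla_relLengthInt_eventuallyEq_zero (zs : List ((ℕ × ℕ) × R)) :
    ∀ (done : List ((ℕ × ℕ) × R)) (A C : ℕ × ℕ → Ideal R),
    IsEventualReduction m I (done ++ zs) → IsBigraded m I A → IsBigraded m I C →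
    (∀ g, C g ≤ A g) → (∀ᶠ g in atTop, relLength (A g) (C g) ≠ ⊤) →
    (∀ z ∈ done, ∀ g, Ideal.span {z.2} * A g ≤ C (z.1 + g)) →
    iterNabla (zs.map Prod.fst) (fun g => relLengthInt (A g) (C g)) =ᶠ[atTop] 0 := by
  induction zs with
  | nil =>
    intro done A C hred hA hC hCA hfin hkill
    rw [List.append_nil] at hred
    have hdeg : ∀ᶠ h : ℕ × ℕ in atTop, ∀ z ∈ done, z.1 ≤ h := by
      have : ∀ᶠ h : ℕ × ℕ in atTop, ∀ z ∈ {z | z ∈ done}, z.1 ≤ h :=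
        (eventually_all_finite (List.finite_toSet done)).2 fun z _ => eventually_ge_atTop z.1
      exact this
    have hle : ∀ᶠ g in atTop, A g ≤ C g := by
      refine hA.eventually_le ?_
      filter_upwards [hred.eventually_le, hdeg] with h hh hd g
      refine (Ideal.mul_mono_left hh).trans ?_
      rw [Ideal.iSup_mul]
      refine iSup_le fun z => ?_
      rw [Ideal.iSup_mul]
      refine iSup_le fun hz => ?_
      rw [mul_assoc]
      refine (Ideal.mul_mono_right (hA.mul_le g (h - z.1))).trans ?_
      have := hkill z hz (h - z.1 + g)
      rwa [← add_assoc, add_tsub_cancel_of_le (hd z hz)] at this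
    filter_upwards [hle] with g hg
    simp [iterNabla, relLengthInt, relLength_eq_zero_iff.2 hg]
  | cons z zs ih =>
    intro done A C hred hA hC hCA hfin hkill
    have hz : z.2 ∈ bipow m I z.1 := hred.mem z (by simp)
    have hred' : IsEventualReduction m I ((done ++ [z]) ++ zs) := by simpa using hred
    set B : ℕ × ℕ → Ideal R := fun g => C g ⊔ Ideal.span {z.2} * A (g - z.1) with hBdef
    set K : ℕ × ℕ → Ideal R :=
      fun g => A g ⊓ Submodule.comap (LinearMap.mulLeft R z.2) (C (z.1 + g)) with hKdef
    have hB : IsBigraded m I B := hA.sup_span_mul hC hz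
    have hK : IsBigraded m I K := hA.inf_comap hC z.1 z.2
    have hzA : ∀ g, Ideal.span {z.2} * A (g - z.1) ≤ A g := fun g => span_mul_le_of_le hA.mul_le hz
    have hzC : ∀ g, Ideal.span {z.2} * C (g - z.1) ≤ C g := fun g => span_mul_le_of_le hC.mul_le hz
    have hBA : ∀ g, B g ≤ A g := fun g => sup_le (hCA g) (hzA g)
    have hCK : ∀ g, C g ≤ K g := fun g => le_inf (hCA g) fun u hu => by
      have := hzC (z.1 + g)
      rw [add_tsub_cancel_left] at this
      exact this (Ideal.mul_mem_mul (Ideal.mem_span_singleton_self _) hu)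
    have h1 := ih (done ++ [z]) A B hred' hA hB hBA (by
        filter_upwards [hfin] with g hg
        exact ne_top_of_le_ne_top hg (relLength_le_of_le le_sup_left (hBA g))) (by
      intro y hy g
      rcases List.mem_append.1 hy with hy | hy
      · exact (hkill y hy g).trans le_sup_left
      · obtain rfl := List.mem_singleton.1 hy
        refine le_sup_of_le_right ?_
        rw [add_tsub_cancel_left])
    have h2 := ih (done ++ [z]) K C hred' hK hC hCK (by
        filter_upwards [hfin] with g hg
        exact ne_top_of_le_ne_top hg (relLength_mono_left (hCK g) inf_le_left)) (by
      intro y hy g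
      rcases List.mem_append.1 hy with hy | hy
      · exact (Ideal.mul_mono_right inf_le_left).trans (hkill y hy g)
      · obtain rfl := List.mem_singleton.1 hy
        refine Ideal.mul_le.2 fun v hv u hu => ?_
        obtain ⟨a, rfl⟩ := Ideal.mem_span_singleton'.1 hv
        rw [mul_assoc]
        exact Ideal.mul_mem_left _ _ (Submodule.mem_inf.1 hu).2)
    have hstep : nabla z.1 (fun g => relLengthInt (A g) (C g)) =ᶠ[atTop]
        (fun g => relLengthInt (A g) (B g)) - fun g => relLengthInt (K (g - z.1)) (C (g - z.1)) := by
      filter_upwards [hfin, (tendsto_sub_atTop z.1).eventually hfin, eventually_ge_atTop z.1]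
        with g hg hg' hgz
      have := relLengthInt_sub_eq (hCA (g - z.1)) (hCA g) (hzA g) (hzC g) hg' hg
      simp only [nabla, Pi.sub_apply, hKdef, add_tsub_cancel_of_le hgz]
      exact this
    rw [List.map_cons, iterNabla]
    refine (iterNabla_congr _ hstep).trans ?_
    rw [iterNabla_sub, iterNabla_shift _ _ fun g => relLengthInt (K g) (C g)]
    filter_upwards [h1, (tendsto_sub_atTop z.1).eventually h2] with g hg1 hg2
    simp only [Pi.sub_apply, hg1, hg2, Pi.zero_apply, sub_self]

end JointReduction

section JointReduction

open Filter

variable {R : Type*} [CommRing R] {m I : Ideal R}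

/-- For `z` regular modulo `Q`, the kernel of multiplication by `z` from `R ⧸ (B' + Q)` to
`R ⧸ (B + Q)` is a subquotient of `B`. -/
theorem relLength_comap_eq {B B' Q : Ideal R} {z : R} (hB : Ideal.span {z} * B' ≤ B)
    (hz : ∀ u, z * u ∈ Q → u ∈ Q) :
    relLength (⊤ ⊓ Submodule.comap (LinearMap.mulLeft R z) (B ⊔ Q)) (B' ⊔ Q) =
      relLength (B ⊓ (Q ⊔ Ideal.span {z})) (B ⊓ (Ideal.span {z} * B' ⊔ Q)) := by
  set K : Ideal R := ⊤ ⊓ Submodule.comap (LinearMap.mulLeft R z) (B ⊔ Q) with hK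
  have hmemK : ∀ u, u ∈ K ↔ z * u ∈ B ⊔ Q := fun u => by simp [hK]
  set E := Ideal.span {z} * B' ⊔ Q with hE
  have h1 : K ⊓ Submodule.comap (LinearMap.mulLeft R z) E = B' ⊔ Q := by
    refine le_antisymm (fun u hu => ?_) (sup_le (fun v hv => ?_) fun q hq => ?_)
    · have hu2 : z * u ∈ E := (Submodule.mem_inf.1 hu).2
      obtain ⟨w, hw, q, hq, h⟩ := Submodule.mem_sup.1 hu2
      obtain ⟨v, hv, rfl⟩ := Ideal.mem_span_singleton_mul.1 hw
      rw [show u = v + (u - v) by ring]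
      refine Submodule.add_mem_sup hv (hz _ ?_)
      convert hq using 1
      linear_combination -h
    · have hzv : z * v ∈ Ideal.span {z} * B' :=
        Ideal.mul_mem_mul (Ideal.mem_span_singleton_self z) hv
      exact Submodule.mem_inf.2 ⟨(hmemK v).2 (Ideal.mem_sup_left (hB hzv)),
        Ideal.mem_sup_left hzv⟩
    · have hzq : z * q ∈ Q := Q.mul_mem_left z hq
      exact Submodule.mem_inf.2 ⟨(hmemK q).2 (Ideal.mem_sup_right hzq), Ideal.mem_sup_right hzq⟩
  have h2 : E ⊔ Ideal.span {z} * K = E ⊔ B ⊓ (Q ⊔ Ideal.span {z}) := by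
    refine le_antisymm (sup_le le_sup_left fun w hw => ?_) (sup_le le_sup_left fun b hb => ?_)
    · obtain ⟨k, hk, rfl⟩ := Ideal.mem_span_singleton_mul.1 hw
      obtain ⟨b, hb, q, hq, h⟩ := Submodule.mem_sup.1 ((hmemK k).1 hk)
      rw [← h, add_comm]
      refine Submodule.add_mem_sup (Ideal.mem_sup_right hq) (Submodule.mem_inf.2 ⟨hb, ?_⟩)
      refine mul_mem_sup_span_singleton.2 ⟨k, ?_⟩
      convert Q.neg_mem hq using 1
      linear_combination h
    · obtain ⟨hb, hb'⟩ := Submodule.mem_inf.1 hb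
      obtain ⟨v, hv⟩ := mul_mem_sup_span_singleton.1 hb'
      rw [show b = (b - z * v) + z * v by ring]
      refine Submodule.add_mem_sup (Ideal.mem_sup_right hv)
        (Ideal.mul_mem_mul (Ideal.mem_span_singleton_self z) ((hmemK v).2 ?_))
      rw [show z * v = b - (b - z * v) by ring]
      exact Ideal.sub_mem _ (Ideal.mem_sup_left hb) (Ideal.mem_sup_right hv)
  have h3 : B ⊓ (Q ⊔ Ideal.span {z}) ⊓ E = B ⊓ E := by
    have hE' : E ≤ Q ⊔ Ideal.span {z} := sup_le (le_sup_of_le_right Ideal.mul_le_left) le_sup_left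
    rw [inf_assoc, inf_eq_right.2 hE']
  rw [← h1, ← relLength_sup_span_mul, h2, relLength_sup_eq, h3]

variable [IsNoetherianRing R]

/-- For a joint reduction that is a regular sequence modulo `Q`, the iterated difference of the
length of `R ⧸ (𝔪 ^ r I ^ s + Q)` is the colength of the ideal it generates with `Q`. -/
theorem iterNabla_relLengthInt_top (hfin : ∀ᶠ g in atTop, relLength ⊤ (bipow m I g) ≠ ⊤)
    (zs : List ((ℕ × ℕ) × R)) : ∀ (done : List ((ℕ × ℕ) × R)) (Q : Ideal R),
    IsEventualReduction m I (done ++ zs) → (∀ z ∈ done, z.2 ∈ Q) →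
    IsRegularMod Q (zs.map Prod.snd) →
    iterNabla (zs.map Prod.fst) (fun g => relLengthInt ⊤ (bipow m I g ⊔ Q)) =ᶠ[atTop]
      fun _ => relLengthInt ⊤ (Q ⊔ Ideal.ofList (zs.map Prod.snd)) := by
  induction zs with
  | nil =>
    intro done Q hred hdone _
    rw [List.append_nil] at hred
    filter_upwards [hred.eventually_le] with g hg
    have hgQ : bipow m I g ≤ Q := hg.trans (iSup₂_le fun z hz =>
      Ideal.mul_le_left.trans ((Ideal.span_singleton_le_iff_mem _).2 (hdone z hz)))
    simp [iterNabla, sup_eq_right.2 hgQ]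
  | cons z zs ih =>
    rintro done Q hred hdone ⟨hzreg, hreg⟩
    have hz : z.2 ∈ bipow m I z.1 := hred.mem z (by simp)
    have hred' : IsEventualReduction m I ((done ++ [z]) ++ zs) := by simpa using hred
    set A : ℕ × ℕ → Ideal R := fun g => bipow m I g ⊓ (Q ⊔ Ideal.span {z.2}) with hAdef
    set C : ℕ × ℕ → Ideal R :=
      fun g => bipow m I g ⊓ (Ideal.span {z.2} * bipow m I (g - z.1) ⊔ Q) with hCdef
    have hJ : ∀ g h, bipow m I h * bipow m I g ≤ bipow m I (h + g) :=
      fun g h => (bipow_add m I h g).ge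
    have hA : IsBigraded m I A := ⟨fun g => inf_le_left, fun g h => le_inf
      ((Ideal.mul_mono_right inf_le_left).trans (hJ g h))
      (Ideal.mul_le_right.trans inf_le_right)⟩
    have hC : IsBigraded m I C := ⟨fun g => inf_le_left, fun g h => le_inf
      ((Ideal.mul_mono_right inf_le_left).trans (hJ g h)) (by
        refine (Ideal.mul_mono_right inf_le_right).trans ?_
        rw [Ideal.mul_sup, mul_left_comm]
        exact sup_le_sup (Ideal.mul_mono_right (mul_sub_le hJ g z.1 h)) Ideal.mul_le_right)⟩
    have hCA : ∀ g, C g ≤ A g := fun g => inf_le_inf le_rfl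
      (sup_le (le_sup_of_le_right Ideal.mul_le_left) le_sup_left)
    have hzJ : ∀ g, Ideal.span {z.2} * bipow m I (g - z.1) ≤ bipow m I g :=
      fun g => span_mul_le_of_le hJ hz
    have hfinQ : ∀ᶠ g in atTop, relLength ⊤ (bipow m I g ⊔ Q) ≠ ⊤ := by
      filter_upwards [hfin] with g hg
      exact ne_top_of_le_ne_top hg (relLength_le_of_le le_sup_left le_top)
    have h1 := ih (done ++ [z]) (Q ⊔ Ideal.span {z.2}) hred' (by
      intro y hy
      rcases List.mem_append.1 hy with hy | hy
      · exact Ideal.mem_sup_left (hdone y hy)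
      · obtain rfl := List.mem_singleton.1 hy
        exact Ideal.mem_sup_right (Ideal.mem_span_singleton_self _)) hreg
    have hlen : ∀ g, relLength (⊤ ⊓ Submodule.comap (LinearMap.mulLeft R z.2) (bipow m I g ⊔ Q))
        (bipow m I (g - z.1) ⊔ Q) = relLength (A g) (C g) :=
      fun g => relLength_comap_eq (hzJ g) hzreg
    have hzJQ : ∀ g, Ideal.span {z.2} * (bipow m I (g - z.1) ⊔ Q) ≤ bipow m I g ⊔ Q := fun g => by
      rw [Ideal.mul_sup]
      exact sup_le_sup (hzJ g) Ideal.mul_le_right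
    have h2 := iterNabla_relLengthInt_eventuallyEq_zero zs (done ++ [z]) A C hred' hA hC hCA (by
        filter_upwards [(tendsto_sub_atTop z.1).eventually hfinQ] with g hg
        rw [← hlen]
        refine ne_top_of_le_ne_top hg (relLength_mono_left (le_inf le_top fun u hu => ?_) le_top)
        exact hzJQ g (Ideal.mul_mem_mul (Ideal.mem_span_singleton_self _) hu)) (by
      intro y hy g
      have hyJ : y.2 ∈ bipow m I y.1 := hred'.mem y (List.mem_append_left _ hy)
      have hyA : Ideal.span {y.2} * A g ≤ bipow m I (y.1 + g) :=
        (Ideal.mul_mono ((Ideal.span_singleton_le_iff_mem _).2 hyJ) inf_le_left).trans (hJ g y.1)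
      refine le_inf hyA ?_
      rcases List.mem_append.1 hy with hy | hy
      · exact le_sup_of_le_right
          (Ideal.mul_le_left.trans ((Ideal.span_singleton_le_iff_mem _).2 (hdone y hy)))
      · obtain rfl := List.mem_singleton.1 hy
        rw [add_tsub_cancel_left]
        exact le_sup_of_le_left (Ideal.mul_mono_right inf_le_left))
    have hstep : nabla z.1 (fun g => relLengthInt ⊤ (bipow m I g ⊔ Q)) =ᶠ[atTop]
        (fun g => relLengthInt ⊤ (bipow m I g ⊔ (Q ⊔ Ideal.span {z.2}))) -
          fun g => relLengthInt (A g) (C g) := by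
      filter_upwards [hfinQ, (tendsto_sub_atTop z.1).eventually hfinQ] with g hg hg'
      have := relLengthInt_sub_eq (A₁ := ⊤) (A₂ := ⊤) le_top le_top le_top (hzJQ g) hg' hg
      simp only [nabla, Pi.sub_apply]
      rw [this, Ideal.mul_top, sup_assoc]
      congr 1
      rw [relLengthInt, relLengthInt, hlen]
    rw [List.map_cons, iterNabla]
    refine (iterNabla_congr _ hstep).trans ?_
    rw [iterNabla_sub]
    filter_upwards [h1, h2] with g hg1 hg2
    simp only [Pi.sub_apply, hg1, hg2, Pi.zero_apply, sub_zero, List.map_cons, Ideal.ofList_cons,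
      sup_assoc]

end JointReduction

section Bhattacharya

open Filter

/-- The polynomial `∑_{i + j ≤ d} e_{ij} (r + i choose i) (s + j choose j)`. -/
def bhattacharyaPoly (d : ℕ) (e : ℕ → ℕ → ℤ) (g : ℕ × ℕ) : ℤ :=
  ∑ k ∈ Finset.range (d + 1), ∑ p ∈ Finset.HasAntidiagonal.antidiagonal k,
    e p.1 p.2 * (((g.1 + p.1).choose p.1 : ℕ) : ℤ) * (((g.2 + p.2).choose p.2 : ℕ) : ℤ)

theorem choose_sub_choose (r i : ℕ) :
    (((r + 1 + (i + 1)).choose (i + 1) : ℕ) : ℤ) - ((r + (i + 1)).choose (i + 1) : ℕ) =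
      ((r + 1 + i).choose i : ℕ) := by
  have : (r + 1 + (i + 1)).choose (i + 1) = (r + 1 + i).choose i + (r + 1 + i).choose (i + 1) :=
    Nat.choose_succ_succ (r + 1 + i) i
  rw [this, show r + (i + 1) = r + 1 + i by ring]
  push_cast
  ring

theorem nabla_fst_bhattacharyaPoly (d : ℕ) (e : ℕ → ℕ → ℤ) :
    nabla (1, 0) (bhattacharyaPoly (d + 1) e) =ᶠ[atTop]
      bhattacharyaPoly d fun i j => e (i + 1) j := by
  filter_upwards [eventually_ge_atTop (1, 1)] with g hg
  obtain ⟨⟨r, s⟩, rfl⟩ := exists_add_of_le hg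
  have hg' : ((1, 1) + (r, s) : ℕ × ℕ) - (1, 0) = (r, s + 1) := by
    ext <;> simp [add_comm]
  rw [nabla, hg', bhattacharyaPoly, bhattacharyaPoly, bhattacharyaPoly, ← Finset.sum_sub_distrib,
    Finset.sum_range_succ']
  simp only [Finset.Nat.sum_antidiagonal_succ, Prod.mk_add_mk]
  rw [Finset.Nat.antidiagonal_zero, Finset.sum_singleton, Finset.sum_singleton]
  simp only [Nat.choose_zero_right, add_sub_add_comm, ← Finset.sum_sub_distrib, add_comm 1 r,
    add_comm 1 s, sub_self, zero_add, add_zero]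
  refine Finset.sum_congr rfl fun k _ => Finset.sum_congr rfl fun p _ => ?_
  linear_combination (e (p.1 + 1) p.2 * ((s + 1 + p.2).choose p.2 : ℕ)) * choose_sub_choose r p.1

theorem nabla_snd_bhattacharyaPoly (d : ℕ) (e : ℕ → ℕ → ℤ) :
    nabla (0, 1) (bhattacharyaPoly (d + 1) e) =ᶠ[atTop]
      bhattacharyaPoly d fun i j => e i (j + 1) := by
  filter_upwards [eventually_ge_atTop (1, 1)] with g hg
  obtain ⟨⟨r, s⟩, rfl⟩ := exists_add_of_le hg
  have hg' : ((1, 1) + (r, s) : ℕ × ℕ) - (0, 1) = (r + 1, s) := by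
    ext <;> simp [add_comm]
  rw [nabla, hg', bhattacharyaPoly, bhattacharyaPoly, bhattacharyaPoly, ← Finset.sum_sub_distrib,
    Finset.sum_range_succ']
  simp only [Finset.Nat.sum_antidiagonal_succ', Prod.mk_add_mk]
  rw [Finset.Nat.antidiagonal_zero, Finset.sum_singleton, Finset.sum_singleton]
  simp only [Nat.choose_zero_right, add_sub_add_comm, ← Finset.sum_sub_distrib, add_comm 1 r,
    add_comm 1 s, sub_self, zero_add, add_zero]
  refine Finset.sum_congr rfl fun k _ => Finset.sum_congr rfl fun p _ => ?_
  linear_combination (e p.1 (p.2 + 1) * ((r + 1 + p.1).choose p.1 : ℕ)) * choose_sub_choose s p.2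

/-- The iterated difference of order `d` picks out the mixed multiplicity. -/
theorem iterNabla_bhattacharyaPoly (n : ℕ) : ∀ e : ℕ → ℕ → ℤ,
    iterNabla ((1, 0) :: List.replicate n (0, 1)) (bhattacharyaPoly (n + 1) e) =ᶠ[atTop]
      fun _ => e 1 n := by
  have key : ∀ (n : ℕ) (e : ℕ → ℕ → ℤ), iterNabla (List.replicate n (0, 1)) (bhattacharyaPoly n e)
      =ᶠ[atTop] fun _ => e 0 n := by
    intro n
    induction n with
    | zero =>
      intro e
      refine Eventually.of_forall fun g => ?_
      simp [iterNabla, bhattacharyaPoly]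
    | succ n ih =>
      intro e
      rw [List.replicate_succ, iterNabla]
      exact (iterNabla_congr _ (nabla_snd_bhattacharyaPoly n e)).trans (ih _)
  intro e
  rw [iterNabla]
  exact (iterNabla_congr _ (nabla_fst_bhattacharyaPoly n e)).trans (key n _)

theorem IsBhattacharyaCoeffs.eventually_length {R : Type*} [CommRing R] [IsLocalRing R]
    {I : Ideal R} {d : ℕ} {e : ℕ → ℕ → ℤ} (he : IsBhattacharyaCoeffs I d e) :
    (∀ᶠ g in atTop, relLength ⊤ (bipow (maximalIdeal R) I g) ≠ ⊤) ∧
      (fun g => relLengthInt ⊤ (bipow (maximalIdeal R) I g)) =ᶠ[atTop] bhattacharyaPoly d e := by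
  obtain ⟨N, hN⟩ := he
  have : ∀ᶠ g : ℕ × ℕ in atTop, ∃ l : ℕ, relLength ⊤ (bipow (maximalIdeal R) I g) = (l : ℕ∞) ∧
      (l : ℤ) = bhattacharyaPoly d e g := by
    filter_upwards [eventually_ge_atTop (N, N)] with g hg
    rw [relLength_top]
    exact hN g.1 g.2 hg.1 hg.2
  constructor
  · filter_upwards [this] with g hg
    obtain ⟨l, hl, -⟩ := hg
    simp [hl]
  · filter_upwards [this] with g hg
    obtain ⟨l, hl, hl'⟩ := hg
    simp [relLengthInt, hl, hl']

/-- The mixed multiplicity of `𝔪` and `I` is the colength of a joint reduction that is a regular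
sequence. -/
theorem relLengthInt_eq_mixedMultiplicity {R : Type*} [CommRing R] [IsLocalRing R]
    [IsNoetherianRing R] {I : Ideal R} {n : ℕ} {e : ℕ → ℕ → ℤ}
    (he : IsBhattacharyaCoeffs I (n + 1) e) {x : R} {L : List R} (hL : L.length = n)
    (hred : IsEventualReduction (maximalIdeal R) I (((1, 0), x) :: L.map fun a => ((0, 1), a)))
    (hreg : IsRegularMod ⊥ (x :: L)) :
    relLengthInt ⊤ (Ideal.ofList (x :: L)) = e 1 n := by
  obtain ⟨hfin, hlen⟩ := he.eventually_length
  have h1 := iterNabla_relLengthInt_top hfin (((1, 0), x) :: L.map fun a => ((0, 1), a)) [] ⊥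
    (by simpa using hred) (by simp) (by simpa [Function.comp_def] using hreg)
  have h2 := (iterNabla_congr ((1, 0) :: List.replicate n (0, 1)) hlen).trans
    (iterNabla_bhattacharyaPoly n e)
  have hmap : (((1, 0), x) :: L.map fun a => (((0, 1) : ℕ × ℕ), a)).map Prod.fst =
      (1, 0) :: List.replicate n (0, 1) := by
    simp [Function.comp_def, ← hL, List.map_const']
  rw [hmap] at h1
  simp only [sup_bot_eq, bot_sup_eq] at h1
  obtain ⟨g, hg1, hg2⟩ := (h1.and h2).exists
  rw [hg1] at hg2
  simpa [Function.comp_def] using hg2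

end Bhattacharya

/-! ### Ideals of minimal mixed multiplicity -/

section MinimalMultiplicity

open Filter

variable {R : Type*} [CommRing R]

theorem relLength_sup_span_le (D K : Ideal R) (z : R) (h : Ideal.span {z} * K ≤ D) :
    relLength (D ⊔ Ideal.span {z}) D ≤ relLength ⊤ K := by
  have := relLength_sup_span_mul ⊤ D z
  rw [Ideal.mul_top] at this
  rw [this]
  exact relLength_le_of_le
    (le_inf le_top fun k hk => h (Ideal.mul_mem_mul (Ideal.mem_span_singleton_self z) hk)) inf_le_left

variable [IsLocalRing R]

theorem relLength_top_maximalIdeal : relLength ⊤ (maximalIdeal R) = 1 := by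
  rw [relLength_top, Module.length_eq_one_iff, isSimpleModule_iff_isCoatom]
  exact (maximalIdeal.isMaximal R).out

/-- Adding generators that are killed by `𝔪` modulo `D` increases the length by at most one each. -/
theorem relLength_sup_ofList_le (L : List R) : ∀ D : Ideal R,
    (∀ a ∈ L, Ideal.span {a} * maximalIdeal R ≤ D) →
    relLength (D ⊔ Ideal.ofList L) D ≤ L.length := by
  induction L with
  | nil =>
    intro D _
    simp [relLength_eq_zero_iff]
  | cons a L ih =>
    intro D hD
    rw [Ideal.ofList_cons, ← sup_assoc, relLength_add (B := D ⊔ Ideal.span {a}) le_sup_left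
      le_sup_left, List.length_cons, Nat.cast_succ, add_comm]
    refine add_le_add (ih _ fun b hb => (hD b (List.mem_cons_of_mem _ hb)).trans le_sup_left) ?_
    exact (relLength_sup_span_le _ _ _ (hD a (by simp))).trans relLength_top_maximalIdeal.le

variable [IsNoetherianRing R]

theorem relLength_maximalIdeal_mul (I : Ideal R) :
    relLength I (maximalIdeal R * I) = (Submodule.spanFinrank I : ℕ∞) := by
  have hsub : (maximalIdeal R * I).submoduleOf I = maximalIdeal R • (⊤ : Submodule R I) := by
    refine Submodule.map_injective_of_injective I.injective_subtype ?_
    rw [Submodule.map_smul'', Submodule.map_top, Submodule.range_subtype, Submodule.submoduleOf,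
      Submodule.map_comap_subtype, smul_eq_mul]
    exact inf_eq_right.2 Ideal.mul_le_right
  rw [relLength, hsub, IsLocalRing.spanFinrank_eq_finrank_quotient I (IsNoetherian.noetherian I),
    Module.length_eq_of_surjective (S := R) (R := R ⧸ maximalIdeal R)
      Ideal.Quotient.mk_surjective]
  let := Ideal.Quotient.field (maximalIdeal R)
  have : Module.Finite (R ⧸ maximalIdeal R) (I ⧸ maximalIdeal R • (⊤ : Submodule R I)) :=
    Module.Finite.of_restrictScalars_finite R _ _
  exact Module.length_eq_finrank (R ⧸ maximalIdeal R) (I ⧸ maximalIdeal R • (⊤ : Submodule R I))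

/-- If `I` has minimal mixed multiplicity, then `𝔪 I = x I + (a₁, …, a_n) 𝔪` for every joint
reduction: the quotient of `I` by the right hand side has length at most
`e + n`, which is the length of `I ⧸ 𝔪 I`. -/
theorem maximalIdeal_mul_le_of_minimal {I : Ideal R} {n : ℕ} {e : ℕ → ℕ → ℤ}
    (he : IsBhattacharyaCoeffs I (n + 1) e)
    (hmin : (Submodule.spanFinrank I : ℤ) = e 1 n + n) {x : R} (hx : x ∈ maximalIdeal R)
    {L : List R} (hLI : ∀ a ∈ L, a ∈ I) (hL : L.length = n)
    (hred : IsEventualReduction (maximalIdeal R) I (((1, 0), x) :: L.map fun a => ((0, 1), a)))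
    (hreg : IsRegularMod ⊥ (x :: L)) :
    maximalIdeal R * I ≤ Ideal.span {x} * I ⊔ Ideal.ofList L * maximalIdeal R := by
  set D := Ideal.span {x} * I ⊔ Ideal.ofList L * maximalIdeal R with hD
  have hLI' : Ideal.ofList L ≤ I := Ideal.span_le.2 hLI
  have hxm : Ideal.span {x} ≤ maximalIdeal R := (Ideal.span_singleton_le_iff_mem _).2 hx
  have hDm : D ≤ maximalIdeal R * I := sup_le (Ideal.mul_mono_left hxm) (by
    rw [mul_comm]
    exact Ideal.mul_mono_right hLI')
  have hDI : D ≤ I := hDm.trans Ideal.mul_le_right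
  have hDq : D ≤ Ideal.ofList (x :: L) := by
    rw [Ideal.ofList_cons]
    exact sup_le_sup Ideal.mul_le_left Ideal.mul_le_left
  obtain ⟨g, hg, hgfin, hge⟩ := (hred.eventually_le.and
    (he.eventually_length.1.and (eventually_ge_atTop ((2, 2) : ℕ × ℕ)))).exists
  have hgD : bipow (maximalIdeal R) I g ≤ D := by
    have h1 : 1 ≤ g.1 := le_trans one_le_two hge.1
    have h2 : 1 ≤ g.2 := le_trans one_le_two hge.2
    refine hg.trans (iSup₂_le fun z hz => ?_)
    rcases List.mem_cons.1 hz with rfl | hz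
    · refine le_sup_of_le_left (Ideal.mul_mono_right (Ideal.mul_le_right.trans ?_))
      exact Ideal.pow_le_self (by simpa using Nat.one_le_iff_ne_zero.1 h2)
    · obtain ⟨a, ha, rfl⟩ := List.mem_map.1 hz
      refine le_sup_of_le_right (Ideal.mul_mono ?_ (Ideal.mul_le_left.trans ?_))
      · exact (Ideal.span_singleton_le_iff_mem _).2 (Ideal.subset_span ha)
      · exact Ideal.pow_le_self (by simpa using Nat.one_le_iff_ne_zero.1 h1)
  have hfinD : relLength ⊤ D ≠ ⊤ := ne_top_of_le_ne_top hgfin (relLength_le_of_le hgD le_top)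
  have hfinI : relLength ⊤ I ≠ ⊤ := ne_top_of_le_ne_top hfinD (relLength_le_of_le hDI le_top)
  have hq := relLengthInt_eq_mixedMultiplicity he hL hred hreg
  have h1 : relLength (Ideal.ofList (x :: L)) D ≤ relLength ⊤ I + n := by
    rw [← hL]
    have hqD : Ideal.ofList (x :: L) = D ⊔ Ideal.span {x} ⊔ Ideal.ofList L := by
      rw [sup_assoc, ← Ideal.ofList_cons, sup_eq_right.2 hDq]
    rw [hqD, relLength_add (B := D ⊔ Ideal.span {x}) le_sup_left le_sup_left]
    refine add_le_add (relLength_sup_span_le _ _ _ le_sup_left) (relLength_sup_ofList_le L _ ?_)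
    intro a ha
    refine le_sup_of_le_left (le_sup_of_le_right (Ideal.mul_mono_left ?_))
    exact (Ideal.span_singleton_le_iff_mem _).2 (Ideal.subset_span ha)
  have h2 := relLengthInt_add hDq le_top hfinD
  have h3 := relLengthInt_add hDI le_top hfinD
  have hfinID : relLength I D ≠ ⊤ := ne_top_of_le_ne_top hfinD (relLength_mono_left hDI le_top)
  have h4 := relLengthInt_add hDm Ideal.mul_le_right hfinID
  have h5 : relLengthInt I (maximalIdeal R * I) = Submodule.spanFinrank I := by
    rw [relLengthInt, relLength_maximalIdeal_mul, ENat.toNat_natCast]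
  have h6 : relLengthInt (Ideal.ofList (x :: L)) D ≤ relLengthInt ⊤ I + n := by
    have h7 : relLength ⊤ I + n ≠ ⊤ := by simpa using hfinI
    have h8 := ENat.toNat_le_toNat h1 h7
    rw [ENat.toNat_add hfinI (by simp), ENat.toNat_natCast] at h8
    unfold relLengthInt
    exact_mod_cast h8
  have h9 : relLengthInt (maximalIdeal R * I) D ≤ 0 := by linarith
  have hfinm : relLength (maximalIdeal R * I) D ≠ ⊤ :=
    ne_top_of_le_ne_top hfinID (relLength_mono_left hDm Ideal.mul_le_right)
  rw [← relLength_eq_zero_iff]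
  have h10 : (relLength (maximalIdeal R * I) D).toNat = 0 := by
    have : ((relLength (maximalIdeal R * I) D).toNat : ℤ) ≤ 0 := h9
    omega
  exact ((ENat.toNat_eq_zero).1 h10).resolve_right hfinm

end MinimalMultiplicity

/-! ### Existence of joint reductions -/

section Existence

open Filter

variable {R : Type*} [CommRing R]

/-- The map `a ↦ a t` from `I` to the Rees algebra. -/
noncomputable def reesDegreeOneLinear (I : Ideal R) : I →ₗ[R] reesAlgebra I where
  toFun := reesDegreeOne
  map_add' a b := by
    ext1
    simp [reesDegreeOne]
  map_smul' r a := by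
    ext1
    simp [reesDegreeOne, Polynomial.smul_monomial]

/-- If `J` contains `I` and the homogeneous maximal ideal of `R[It]` contains a nonzerodivisor
modulo `J`, then only elements of `J` are multiplied into `J` by `I t`: some power of the
homogeneous maximal ideal lies in the ideal generated by `I` and `I t`. -/
theorem mem_of_reesDegreeOne_mul_mem [IsLocalRing R] [IsNoetherianRing R] {I : Ideal R} {k : ℕ}
    (hk : maximalIdeal R ^ k ≤ I) {J : Ideal (reesAlgebra I)}
    (hJ : I.map (algebraMap R (reesAlgebra I)) ≤ J) {y : reesAlgebra I}
    (hy : y ∈ reesMaximalIdeal I) (hyr : ∀ u, y * u ∈ J → u ∈ J) (u : reesAlgebra I)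
    (hu : ∀ a : I, reesDegreeOne a * u ∈ J) : u ∈ J := by
  obtain ⟨S, hS⟩ := (IsNoetherian.noetherian I : I.FG)
  obtain ⟨L, hL⟩ : ∃ L : List I, Ideal.ofList (L.map Subtype.val) = I := by
    have hSI : ∀ r ∈ S.toList, r ∈ I := fun r hr => hS ▸ Ideal.subset_span (by simpa using hr)
    refine ⟨S.toList.pmap Subtype.mk hSI, ?_⟩
    rw [List.map_pmap, List.pmap_eq_map, List.map_id']
    exact (congrArg Ideal.span (by ext; simp)).trans hS
  have hle : reesIdeal I (Ideal.ofList (L.map Subtype.val)) hL.le ≤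
      Submodule.comap (LinearMap.mulRight (reesAlgebra I) u) J := by
    rw [← map_sup_ofList_eq_reesIdeal I L hL.le]
    refine sup_le (fun f hf => J.mul_mem_right u (hJ hf)) (Ideal.span_le.2 fun f hf => ?_)
    obtain ⟨a, -, rfl⟩ := List.mem_map.1 hf
    exact hu a
  have hyk : y ^ k * u ∈ J := by
    refine hle (fun n => ?_)
    have hmem := (mem_reesAlgebra_iff I _).1 (y ^ k).2 n
    rw [hL]
    cases n with
    | zero =>
      refine Ideal.mem_sup_left ?_
      rw [pow_zero, mul_one]
      have h0 : ((y ^ k : reesAlgebra I) : Polynomial R).coeff 0 =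
          ((y : Polynomial R).coeff 0) ^ k := by
        rw [SubmonoidClass.coe_pow, Polynomial.coeff_zero_eq_eval_zero,
          Polynomial.coeff_zero_eq_eval_zero, Polynomial.eval_pow]
      rw [h0]
      have hy0 : (y : Polynomial R).coeff 0 ∈ maximalIdeal R := hy
      exact hk (Ideal.pow_mem_pow hy0 k)
    | succ n =>
      refine Ideal.mem_sup_right ?_
      rwa [Nat.add_sub_cancel, ← pow_succ']
  have hdescend : ∀ j, y ^ j * u ∈ J → u ∈ J := by
    intro j
    induction j with
    | zero => simp
    | succ j ih =>
      intro h
      rw [pow_succ', mul_assoc] at h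
      exact ih (hyr _ h)
  exact hdescend k hyk

variable {m I : Ideal R}

/-- Dividing by a filter-regular element amounts to taking a difference of the Hilbert function. -/
theorem nabla_relLengthInt_of_filterRegular {C : ℕ × ℕ → Ideal R} (hC : IsBigraded m I C)
    (hfin : ∀ᶠ g in atTop, relLength (bipow m I g) (C g) ≠ ⊤) {h : ℕ × ℕ} {z : R}
    (hz : z ∈ bipow m I h)
    (hreg : ∀ᶠ g in atTop, ∀ u ∈ bipow m I g, z * u ∈ C (h + g) → u ∈ C g) :
    IsBigraded m I (fun g => C g ⊔ Ideal.span {z} * bipow m I (g - h)) ∧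
    (∀ᶠ g in atTop, relLength (bipow m I g) (C g ⊔ Ideal.span {z} * bipow m I (g - h)) ≠ ⊤) ∧
    nabla h (fun g => relLengthInt (bipow m I g) (C g)) =ᶠ[atTop]
      fun g => relLengthInt (bipow m I g) (C g ⊔ Ideal.span {z} * bipow m I (g - h)) := by
  have hJ : IsBigraded m I (bipow m I) := ⟨fun _ => le_rfl, fun g h => (bipow_add m I h g).ge⟩
  have hzJ : ∀ g, Ideal.span {z} * bipow m I (g - h) ≤ bipow m I g :=
    fun g => span_mul_le_of_le hJ.mul_le hz
  refine ⟨hJ.sup_span_mul hC hz, ?_, ?_⟩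
  · filter_upwards [hfin] with g hg
    exact ne_top_of_le_ne_top hg (relLength_le_of_le le_sup_left (sup_le (hC.le g) (hzJ g)))
  · filter_upwards [hfin, (tendsto_sub_atTop h).eventually hfin,
      (tendsto_sub_atTop h).eventually hreg, eventually_ge_atTop h] with g hg hg' hgreg hgh
    have := relLengthInt_sub_eq (hC.le (g - h)) (hC.le g) (hzJ g) (span_mul_le_of_le hC.mul_le hz)
      hg' hg
    rw [nabla, this]
    have hzero : relLength (bipow m I (g - h) ⊓ Submodule.comap (LinearMap.mulLeft R z) (C g))
        (C (g - h)) = 0 := by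
      rw [relLength_eq_zero_iff]
      intro u hu
      obtain ⟨hu₁, hu₂⟩ := Submodule.mem_inf.1 hu
      refine hgreg u hu₁ ?_
      rwa [add_tsub_cancel_of_le hgh]
    simp [relLengthInt, hzero]

variable [IsNoetherianRing R] [IsLocalRing R] [Infinite (ResidueField R)]

/-- General elements of `I` form a filter-regular sequence on the bigraded Rees algebra modulo `C`
and a regular sequence on `R[It] ⧸ J`, as far as the grade allows. -/
theorem exists_general_sequence {I : Ideal R} {k : ℕ} (hk : maximalIdeal R ^ k ≤ I) (n : ℕ) :
    ∀ (J : Ideal (reesAlgebra I)) (C : ℕ × ℕ → Ideal R),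
    I.map (algebraMap R (reesAlgebra I)) ≤ J →
    (∃ L : List (reesAlgebra I), L.length = n ∧ (∀ y ∈ L, y ∈ reesMaximalIdeal I) ∧
      IsRegularMod J L) →
    IsBigraded (maximalIdeal R) I C →
    (∀ᶠ g in atTop, relLength (bipow (maximalIdeal R) I g) (C g) ≠ ⊤) →
    ∃ L : List I, L.length = n ∧ IsRegularMod J (L.map reesDegreeOne) ∧
      ∃ C' : ℕ × ℕ → Ideal R,
        (∀ᶠ g in atTop, relLength (bipow (maximalIdeal R) I g) (C' g) ≠ ⊤) ∧
        (∀ g, C' g ≤ C g ⊔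
          ⨆ a ∈ L, Ideal.span {(a : R)} * bipow (maximalIdeal R) I (g - (0, 1))) ∧
        iterNabla (List.replicate n (0, 1))
            (fun g => relLengthInt (bipow (maximalIdeal R) I g) (C g)) =ᶠ[atTop]
          fun g => relLengthInt (bipow (maximalIdeal R) I g) (C' g) := by
  induction n with
  | zero =>
    intro J C _ _ hC hfin
    exact ⟨[], rfl, trivial, C, hfin, fun g => le_sup_left, EventuallyEq.rfl⟩
  | succ n ih =>
    rintro J C hJ ⟨L₀, hL₀, hL₀M, hL₀r⟩ hC hfin
    have hle : bipow (maximalIdeal R) I (0, 1) ≤ I := by simp [bipow]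
    have hle' : I ≤ bipow (maximalIdeal R) I (0, 1) := by simp [bipow]
    match L₀, hL₀ with
    | y :: ys, hL₀ =>
    obtain ⟨F₁, hF₁, hne₁, hreg₁⟩ := exists_finite_regular
      ((reesDegreeOneLinear I).comp (Submodule.inclusion hle)) J (fun u hu =>
        mem_of_reesDegreeOne_mul_mem hk hJ (hL₀M y (by simp)) hL₀r.1 u
          fun a => hu ⟨a.1, hle' a.2⟩)
    obtain ⟨F₂, hF₂, hne₂, hreg₂⟩ := exists_finite_filterRegular hC (0, 1)
    obtain ⟨z, hz⟩ := exists_notMem_of_finite_of_ne_top (hF₁.union hF₂)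
      (fun N hN => hN.elim (hne₁ N) (hne₂ N))
    set a : I := ⟨z.1, hle z.2⟩ with ha
    have haJ : ∀ u, reesDegreeOne a * u ∈ J → u ∈ J :=
      hreg₁ z fun N hN => hz N (Or.inl hN)
    have haM : reesDegreeOne a ∈ reesMaximalIdeal I := by
      change (Polynomial.monomial 1 (a : R)).coeff 0 ∈ maximalIdeal R
      simp [Polynomial.coeff_monomial]
    obtain ⟨hC', hfin', hnabla⟩ := nabla_relLengthInt_of_filterRegular hC hfin z.2
      (hreg₂ z fun N hN => hz N (Or.inr hN))
    obtain ⟨L, hL, hLr, C', hC'fin, hC'le, hC'nabla⟩ := ih (J ⊔ Ideal.span {reesDegreeOne a}) _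
      (hJ.trans le_sup_left)
      (exists_isRegularMod_sup_span (reesMaximalIdeal I) n J (y :: ys) hL₀ hL₀M hL₀r _ haM haJ)
      hC' hfin'
    refine ⟨a :: L, by simp [hL], ⟨haJ, hLr⟩, C', hC'fin, fun g => ?_, ?_⟩
    · refine (hC'le g).trans ?_
      simp only [List.mem_cons, iSup_or, iSup_sup_eq, iSup_iSup_eq_left, sup_assoc]
      exact le_rfl
    · rw [List.replicate_succ, iterNabla]
      exact (iterNabla_congr _ hnabla).trans hC'nabla

/-- There is a joint reduction `(x, a₁, …, a_n)` of `𝔪` and `n` copies of `I` for which the initial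
forms of the `a_i` are a regular sequence in `G(I)`, if `G(I)` has depth at least `n`. The
Hilbert function of the bigraded ring `⨁ 𝔪 ^ r I ^ s ⧸ 𝔪 ^ (r + 1) I ^ s` is a polynomial of degree
at most `n`, so that it is killed by the `n + 1` differences given by filter-regular elements. -/
theorem exists_eventualReduction {I : Ideal R} {k : ℕ} (hk : maximalIdeal R ^ k ≤ I) {n : ℕ}
    {e : ℕ → ℕ → ℤ} (he : IsBhattacharyaCoeffs I (n + 1) e)
    (hL₀ : ∃ L : List (reesAlgebra I), L.length = n ∧ (∀ y ∈ L, y ∈ reesMaximalIdeal I) ∧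
      IsRegularMod (I.map (algebraMap R (reesAlgebra I))) L) :
    ∃ x ∈ maximalIdeal R, ∃ L : List I, L.length = n ∧
      IsRegularMod (I.map (algebraMap R (reesAlgebra I))) (L.map reesDegreeOne) ∧
      IsEventualReduction (maximalIdeal R) I
        (((1, 0), x) :: (L.map Subtype.val).map fun a => ((0, 1), a)) := by
  obtain ⟨hfin, hlen⟩ := he.eventually_length
  set P := bipow (maximalIdeal R) I with hP
  have hJ : IsBigraded (maximalIdeal R) I P := ⟨fun _ => le_rfl, fun g h => (bipow_add _ I h g).ge⟩
  set C : ℕ × ℕ → Ideal R := fun g => P ((1, 0) + g) with hCdef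
  have hCP : ∀ g, C g = maximalIdeal R * P g := fun g => by
    rw [hCdef, hP]
    simp only [bipow_add]
    simp [bipow]
  have hC : IsBigraded (maximalIdeal R) I C := ⟨fun g => by rw [hCP]; exact Ideal.mul_le_right,
    fun g h => by
      rw [hCP, hCP, mul_left_comm]
      exact Ideal.mul_mono_right (hJ.mul_le g h)⟩
  have hfin1 : ∀ᶠ g in atTop, relLength ⊤ (C g) ≠ ⊤ :=
    (tendsto_atTop_mono (fun g => le_add_self) tendsto_id :
      Tendsto (fun g : ℕ × ℕ => (1, 0) + g) atTop atTop).eventually hfin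
  have hCfin : ∀ᶠ g in atTop, relLength (P g) (C g) ≠ ⊤ := by
    filter_upwards [hfin1] with g hg
    exact ne_top_of_le_ne_top hg (relLength_mono_left (hC.le g) le_top)
  obtain ⟨F, hF, hne, hreg⟩ := exists_finite_filterRegular hC (1, 0)
  obtain ⟨x, hx⟩ := exists_notMem_of_finite_of_ne_top hF hne
  obtain ⟨hC', hfin', hnabla⟩ := nabla_relLengthInt_of_filterRegular hC hCfin x.2 (hreg x hx)
  obtain ⟨L, hL, hLr, C', hC'fin, hC'le, hC'nabla⟩ := exists_general_sequence hk n _ _ le_rfl hL₀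
    hC' hfin'
  refine ⟨x.1, by simpa [bipow] using x.2, L, hL, hLr, ⟨?_, ?_⟩⟩
  · intro z hz
    rcases List.mem_cons.1 hz with rfl | hz
    · exact x.2
    · simp only [List.map_map, List.mem_map, Function.comp_apply] at hz
      obtain ⟨a, -, rfl⟩ := hz
      simp [bipow]
  · set hs : List (ℕ × ℕ) := (1, 0) :: List.replicate n (0, 1) with hhs
    have h1 : iterNabla hs (fun g => relLengthInt (P g) (C g)) =ᶠ[atTop]
        fun g => relLengthInt (P g) (C' g) :=
      (iterNabla_congr _ hnabla).trans hC'nabla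
    have h2 : iterNabla hs (fun g => relLengthInt ⊤ (P g)) =ᶠ[atTop] fun _ => e 1 n :=
      (iterNabla_congr hs hlen).trans (iterNabla_bhattacharyaPoly n e)
    -- the Hilbert function is a difference of the function `ℓ(R / 𝔪 ^ r I ^ s)`
    have h3 : (fun g => relLengthInt (P (g - (1, 0))) (C (g - (1, 0)))) =ᶠ[atTop]
        (fun g => relLengthInt ⊤ (P g)) - fun g => relLengthInt ⊤ (P (g - (1, 0))) := by
      filter_upwards [hfin, eventually_ge_atTop (1, 0)] with g hg hg1
      have hCg : C (g - (1, 0)) = P g := by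
        rw [hCdef]
        simp only [add_tsub_cancel_of_le hg1]
      have h4 := relLengthInt_add (hC.le (g - (1, 0))) le_top (by rwa [hCg])
      rw [hCg] at h4 ⊢
      simp only [Pi.sub_apply]
      linarith
    have h5 : (fun g => iterNabla hs (fun g => relLengthInt (P g) (C g)) (g - (1, 0)))
        =ᶠ[atTop] 0 := by
      rw [← iterNabla_shift hs (1, 0) fun g => relLengthInt (P g) (C g)]
      refine (iterNabla_congr hs h3).trans ?_
      rw [iterNabla_sub, iterNabla_shift hs (1, 0) fun g => relLengthInt ⊤ (P g)]
      filter_upwards [h2, (tendsto_sub_atTop (1, 0)).eventually h2] with g hg hg'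
      simp only [Pi.sub_apply, hg, hg', Pi.zero_apply, sub_self]
    have h6 : (fun g => relLengthInt (P g) (C' g)) =ᶠ[atTop] 0 := by
      have h7 := (tendsto_atTop_mono (fun g => le_add_self) tendsto_id :
        Tendsto (fun g : ℕ × ℕ => (1, 0) + g) atTop atTop).eventually h5
      filter_upwards [h7, h1] with g hg hg1
      rw [add_tsub_cancel_left] at hg
      rw [← hg1, hg]
      rfl
    filter_upwards [h6, hC'fin] with g hg hgfin
    have hPC : P g ≤ C' g := by
      rw [← relLength_eq_zero_iff]
      have hg0 : ((relLength (P g) (C' g)).toNat : ℤ) = 0 := hg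
      exact (ENat.toNat_eq_zero.1 (by exact_mod_cast hg0)).resolve_right hgfin
    refine Ideal.le_of_le_sup_maximalIdeal_mul (hPC.trans ((hC'le g).trans ?_))
    rw [hCP, sup_comm]
    refine sup_le (le_sup_of_le_left ?_) (sup_le le_sup_right (le_sup_of_le_left ?_))
    · refine iSup₂_le fun a ha => ?_
      refine le_iSup₂_of_le ((0, 1), (a : R)) (List.mem_cons_of_mem _ ?_) le_rfl
      exact List.mem_map_of_mem (List.mem_map_of_mem ha)
    · exact le_iSup₂_of_le ((1, 0), (x : R)) List.mem_cons_self le_rfl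

end Existence

/-! ### Joint reductions and regular sequences in the fiber cone -/

section FiberCone

open Filter

variable {R : Type*} [CommRing R]

/-- A joint reduction of `m, I, …, I` gives the relation on the products `m ^ r * I ^ s` in every
sufficiently large degree. -/
theorem IsJointReduction.isEventualReduction {m I : Ideal R} {n : ℕ} {x : R} {a : Fin n → I}
    (h : IsJointReduction (Fin.cons (α := fun _ : Fin (n + 1) => Ideal R) m (fun _ => I))
      (Fin.cons (α := fun _ : Fin (n + 1) => R) x (fun i => (a i : R)))) :
    IsEventualReduction m I
      (((1, 0), x) :: ((List.ofFn a).map Subtype.val).map fun b => ((0, 1), b)) := by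
  obtain ⟨hmem, k, hk, hred⟩ := h
  set J : Fin (n + 1) → Ideal R := Fin.cons (α := fun _ : Fin (n + 1) => Ideal R) m (fun _ => I)
    with hJ
  have hprod : ∏ i, J i = m * I ^ n := by
    rw [Fin.prod_univ_succ]; simp [hJ]
  have herase_zero : ∏ i ∈ Finset.univ.erase (0 : Fin (n + 1)), J i = I ^ n := by
    rw [Finset.prod_congr rfl (g := fun _ => I)]
    · simp
    · intro i hi
      obtain ⟨i, rfl⟩ := Fin.exists_succ_eq.2 (Finset.ne_of_mem_erase hi)
      rfl
  have herase_succ (i : Fin n) :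
      ∏ j ∈ Finset.univ.erase i.succ, J j = m * I ^ (n - 1) := by
    rw [← Finset.mul_prod_erase _ _ (a := 0)
      (Finset.mem_erase.2 ⟨(Fin.succ_ne_zero i).symm, Finset.mem_univ _⟩),
      Finset.prod_congr rfl (g := fun _ => I)]
    · rw [Finset.prod_const, Finset.card_erase_of_mem (by simp [(Fin.succ_ne_zero i).symm]),
        Finset.card_erase_of_mem (Finset.mem_univ _)]
      simp [hJ]
    · intro j hj
      obtain ⟨j, rfl⟩ := Fin.exists_succ_eq.2 (Finset.ne_of_mem_erase hj)
      rfl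
  refine ⟨?_, ?_⟩
  · intro z hz
    rcases List.mem_cons.1 hz with rfl | hz
    · have hx : x ∈ m := hmem 0
      simpa [bipow] using hx
    · simp only [List.map_map, List.mem_map] at hz
      obtain ⟨b, -, rfl⟩ := hz
      simp [bipow]
  · filter_upwards [eventually_ge_atTop (k, n * k)] with g hg
    obtain ⟨h, rfl⟩ := exists_add_of_le hg
    set zs := (((1, 0), x) :: ((List.ofFn a).map Subtype.val).map fun b => ((0, 1), b) :
      List ((ℕ × ℕ) × R)) with hzs
    have hterm {z : (ℕ × ℕ) × R} (hz : z ∈ zs) {q : ℕ × ℕ} (hq : z.1 + q = (k, n * k)) :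
        bipow m I h * (Ideal.span {z.2} * bipow m I q) ≤
          ⨆ z ∈ zs, Ideal.span {z.2} * bipow m I ((k, n * k) + h - z.1) := by
      refine le_trans (le_of_eq ?_) (le_biSup (fun z : (ℕ × ℕ) × R =>
        Ideal.span {z.2} * bipow m I ((k, n * k) + h - z.1)) hz)
      rw [mul_left_comm, ← bipow_add, ← hq, add_assoc, add_tsub_cancel_left, add_comm]
    have hpow : bipow m I (k, n * k) = (m * I ^ n) ^ k := by
      simp [bipow, mul_pow, pow_mul]
    rw [add_comm, bipow_add, add_comm, hpow, ← hprod, ← hred, hprod, Finset.sum_mul, Finset.mul_sum]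
    obtain ⟨k, rfl⟩ := Nat.exists_eq_add_of_le' hk
    simp only [Ideal.sum_eq_sup, Finset.sup_le_iff]
    intro j _
    induction j using Fin.cases with
    | zero =>
      have := hterm (z := ((1, 0), x)) (by simp [hzs]) (q := (k, n * (k + 1)))
        (by ext <;> simp [add_comm])
      refine le_trans (le_of_eq ?_) this
      rw [herase_zero]
      simp [bipow]
      ring
    | succ i =>
      have hn : 0 < n := i.pos
      obtain ⟨n, rfl⟩ := Nat.exists_eq_add_of_le' hn
      have := hterm (z := ((0, 1), (a i : R)))
        (List.mem_cons_of_mem _ (List.mem_map_of_mem (List.mem_map_of_mem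
          (List.mem_ofFn.2 ⟨i, rfl⟩))))
        (q := (k + 1, (n + 1) * k + n)) (by ext <;> simp; ring)
      refine le_trans (le_of_eq ?_) this
      rw [herase_succ]
      simp [bipow]
      ring

variable [IsLocalRing R] {I : Ideal R}

theorem reesDegreeOne_mem_reesMaximalIdeal (a : I) : reesDegreeOne a ∈ reesMaximalIdeal I := by
  change (Polynomial.monomial 1 (a : R)).coeff 0 ∈ maximalIdeal R
  simp [Polynomial.coeff_monomial]

theorem map_algebraMap_le_reesMaximalIdeal :
    (maximalIdeal R).map (algebraMap R (reesAlgebra I)) ≤ reesMaximalIdeal I := by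
  rw [Ideal.map_le_iff_le_comap]
  intro r hr
  change (Polynomial.C r).coeff 0 ∈ maximalIdeal R
  simpa using hr

theorem reesMaximalIdeal_ne_top : reesMaximalIdeal I ≠ ⊤ :=
  Ideal.comap_ne_top _ (Ideal.IsPrime.ne_top inferInstance)

theorem isRegular_map_circForm_iff {L : List I} :
    RingTheory.Sequence.IsRegular (FiberCone I) (L.map circForm) ↔
      IsRegularMod ((maximalIdeal R).map (algebraMap R (reesAlgebra I))) (L.map reesDegreeOne) := by
  rw [show L.map circForm = (L.map reesDegreeOne).map (Ideal.Quotient.mk _) by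
    simp [Function.comp_def, circForm], isRegular_quotient_iff, and_iff_left]
  refine ne_top_of_le_ne_top reesMaximalIdeal_ne_top
    (sup_le map_algebraMap_le_reesMaximalIdeal (Ideal.span_le.2 ?_))
  intro y hy
  obtain ⟨a, -, rfl⟩ := List.mem_map.1 hy
  exact reesDegreeOne_mem_reesMaximalIdeal a

/-- In a Cohen–Macaulay ring whose dimension is the number of elements of a joint reduction of
`𝔪, I, …, I`, these elements form a regular sequence in any order. -/
theorem IsEventualReduction.isRegularMod_perm (hCM : IsCohenMacaulayLocal R)
    (hI : I.radical = maximalIdeal R) {n : ℕ} (hdim : ringKrullDim R = ((n + 1 : ℕ) : WithBot ℕ∞))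
    {x : R} (hx : x ∈ maximalIdeal R) {L : List R} (hLI : ∀ a ∈ L, a ∈ I) (hL : L.length = n)
    (hred : IsEventualReduction (maximalIdeal R) I (((1, 0), x) :: L.map fun a => ((0, 1), a)))
    {L' : List R} (hL' : L'.Perm (x :: L)) : IsRegularMod ⊥ L' := by
  have hIm : I ≤ maximalIdeal R := hI ▸ Ideal.le_radical
  refine hCM.isRegularMod L' (by simp [hdim, hL'.length_eq, hL]) (fun y hy => ?_) ?_
  · rcases List.mem_cons.1 (hL'.mem_iff.1 hy) with rfl | hy
    exacts [hx, hIm (hLI y hy)]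
  obtain ⟨g, hg⟩ := hred.eventually_le.exists
  have hle : bipow (maximalIdeal R) I g ≤ Ideal.ofList L' := by
    refine hg.trans (iSup₂_le fun z hz => Ideal.mul_le_left.trans ?_)
    rw [Ideal.span_singleton_le_iff_mem]
    refine Ideal.subset_span (hL'.mem_iff.2 ?_)
    rcases List.mem_cons.1 hz with rfl | hz
    · simp
    · obtain ⟨b, hb, rfl⟩ := List.mem_map.1 hz
      exact List.mem_cons_of_mem _ hb
  intro y hy
  obtain ⟨k, hk⟩ : y ∈ I.radical := hI ▸ hy
  refine ⟨g.1 + k * g.2, hle ?_⟩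
  rw [pow_add, pow_mul]
  exact Ideal.mul_mem_mul (Ideal.pow_mem_pow hy _) (Ideal.pow_mem_pow hk _)

/-- For an ideal of minimal mixed multiplicity, an initial part of a joint reduction of
`𝔪, I, …, I` that is regular on `G(I)` is regular on `F(I)`. -/
theorem IsEventualReduction.isRegularMod_fiberCone (hCM : IsCohenMacaulayLocal R)
    (hI : I.radical = maximalIdeal R) {n : ℕ} (hdim : ringKrullDim R = ((n + 1 : ℕ) : WithBot ℕ∞))
    {e : ℕ → ℕ → ℤ} (he : IsBhattacharyaCoeffs I (n + 1) e)
    (hmin : (Submodule.spanFinrank I : ℤ) = e 1 n + n) {x : R} (hx : x ∈ maximalIdeal R)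
    {L₁ L₂ : List I} (hL : (L₁ ++ L₂).length = n)
    (hred : IsEventualReduction (maximalIdeal R) I
      (((1, 0), x) :: ((L₁ ++ L₂).map Subtype.val).map fun a => ((0, 1), a)))
    (hL₁ : IsRegularMod (I.map (algebraMap R (reesAlgebra I))) (L₁.map reesDegreeOne)) :
    IsRegularMod ((maximalIdeal R).map (algebraMap R (reesAlgebra I))) (L₁.map reesDegreeOne) := by
  have := hCM.1
  have hLI : ∀ a ∈ (L₁ ++ L₂).map Subtype.val, a ∈ I := by
    intro a ha
    obtain ⟨b, -, rfl⟩ := List.mem_map.1 ha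
    exact b.2
  have hlen : ((L₁ ++ L₂).map Subtype.val).length = n := by rw [List.length_map, hL]
  have hperm {L' : List R} (hL' : L'.Perm (x :: (L₁ ++ L₂).map Subtype.val)) :
      IsRegularMod ⊥ L' :=
    hred.isRegularMod_perm hCM hI hdim hx hLI hlen hL'
  exact (_root_.isRegularMod_fiberCone (hI ▸ Ideal.le_radical) hx L₁ L₂
    (maximalIdeal_mul_le_of_minimal he hmin hx hLI hlen hred (hperm (List.Perm.refl _)))
    (fun _ => hperm) hL₁).2

end FiberCone

theorem mainTheorem2 {R : Type*} [CommRing R] [IsLocalRing R] [Infinite (ResidueField R)]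
    (hCM : IsCohenMacaulayLocal R) (d : ℕ) (hd : 2 ≤ d) (hdim : ringKrullDim R = (d : WithBot ℕ∞))
    (I : Ideal R) (hI : I.radical = maximalIdeal R) (hmin : HasMinimalMixedMultiplicity I d) :
    (∀ (x : R) (a : Fin (d - 1) → I),
      IsJointReduction
        (Fin.cons (α := fun _ : Fin (d - 1 + 1) => Ideal R) (maximalIdeal R) (fun _ => I))
        (Fin.cons (α := fun _ : Fin (d - 1 + 1) => R) x (fun i => (a i : R))) →
      ∀ (t : ℕ) (ht : t ≤ d - 1),
        RingTheory.Sequence.IsRegular (AssocGradedRing I)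
          (List.ofFn fun i : Fin t => starForm (a (Fin.castLE ht i))) →
        RingTheory.Sequence.IsRegular (FiberCone I)
          (List.ofFn fun i : Fin t => circForm (a (Fin.castLE ht i)))) ∧
    (((d - 1 : ℕ) : ℕ∞) ≤ depthAssocGradedRing I → ((d - 1 : ℕ) : ℕ∞) ≤ depthFiberCone I) := by
  obtain ⟨c, ⟨e, he, rfl⟩, hmin⟩ := hmin
  have := hCM.1
  obtain ⟨n, rfl⟩ : ∃ n, d = n + 1 := ⟨d - 1, by omega⟩
  rw [show n + 1 - (n + 1 - 1) = 1 by omega] at hmin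
  simp only [Nat.add_sub_cancel] at hmin ⊢
  have hmin' : (Submodule.spanFinrank I : ℤ) = e 1 n + n := by rw [hmin]; push_cast; ring
  have hIm : I ≤ maximalIdeal R := hI ▸ Ideal.le_radical
  refine ⟨fun x a hjr t ht hreg => ?_, fun hdepth => ?_⟩
  · have hx : x ∈ maximalIdeal R := hjr.1 0
    have hofFn : (List.ofFn fun i : Fin t => a (Fin.castLE ht i)) = (List.ofFn a).take t := by
      refine List.ext_getElem (by simp [ht]) fun i _ _ => ?_
      simp [Fin.castLE]
    have hcirc : (List.ofFn fun i : Fin t => circForm (a (Fin.castLE ht i))) =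
        ((List.ofFn a).take t).map circForm := by
      rw [← hofFn, List.map_ofFn]; rfl
    have hstar : (List.ofFn fun i : Fin t => starForm (a (Fin.castLE ht i))) =
        (((List.ofFn a).take t).map reesDegreeOne).map (Ideal.Quotient.mk _) := by
      rw [← hofFn, List.map_ofFn, List.map_ofFn]; rfl
    rw [hcirc, isRegular_map_circForm_iff]
    rw [hstar, isRegular_quotient_iff] at hreg
    exact IsEventualReduction.isRegularMod_fiberCone (L₂ := (List.ofFn a).drop t) hCM hI hdim he
      hmin' hx (by simp) (by rw [List.take_append_drop]; exact hjr.isEventualReduction) hreg.1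
  · obtain ⟨k, hk⟩ := Ideal.exists_radical_pow_le_of_fg I (IsNoetherian.noetherian _)
    rw [hI] at hk
    have hL₀ := exists_isRegularMod_of_le_idealGrade Ideal.Quotient.mk_surjective hdepth (by
      rw [Ideal.mk_ker]
      exact (Ideal.map_mono hIm).trans map_algebraMap_le_reesMaximalIdeal)
    rw [Ideal.mk_ker] at hL₀
    obtain ⟨x, hx, L, hL, hLreg, hred⟩ := exists_eventualReduction hk he hL₀
    have hreg := isRegular_map_circForm_iff.2
      (IsEventualReduction.isRegularMod_fiberCone (L₂ := []) hCM hI hdim he hmin' hx (by simpa)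
        (by simpa using hred) hLreg)
    refine le_trans (le_of_eq ?_) (le_iSup (fun rs : {rs : List (FiberCone I) //
      (∀ r ∈ rs, r ∈ (reesMaximalIdeal I).map (Ideal.Quotient.mk _)) ∧
        RingTheory.Sequence.IsRegular (FiberCone I) rs} => (rs.1.length : ℕ∞))
      ⟨L.map circForm, fun r hr => ?_, hreg⟩)
    · simp [hL]
    · obtain ⟨a, -, rfl⟩ := List.mem_map.1 hr
      exact Ideal.mem_map_of_mem _ (reesDegreeOne_mem_reesMaximalIdeal a)
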